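/- A spacetime $(M,g)$ is a connected (Hausdorff) smooth manifold $M$ of finite dimension $m>2$ with a smooth Lorentz metric $g$ of signature $(-,+,\dots,+)$. It is called viable if it admits a complete timelike geodesic, that is, a geodesic $\gamma:\mathbb{R}\to M$ of the Levi-Civita connection of $g$, defined for all values of its affine parameter, with $g(\gamma'(t),\gamma'(t))<0$ for all $t$. Let $(M,g)$ and $(N,h)$ be spacetimes and let $\varphi:M\to N$ be a smooth diffeomorphism that is conformal, i.e. $\varphi^*h=e^{2\sigma}g$ for some smooth function $\sigma:M\to\mathbb{R}$, and that preserves the Ricci tensor, i.e. $\varphi^*\mathrm{Ric}_h=\mathrm{Ric}_g$. If at least one of $(M,g)$ and $(N,h)$ is viable, then $\varphi$ is a homothety: there is a constant $c>0$ with $\varphi^*h=c\,g$. -/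

import Mathlib

open scoped Manifold ContDiff

set_option maxSynthPendingDepth 3

noncomputable section

namespace Spacetime

section Local

variable {E : Type*} [NormedAddCommGroup E] [NormedSpace ℝ E]

/-- The Koszul expression of a field `G` of bilinear forms on a vector space `E`, for constant
vector fields `u`, `v`, `w`: `½ (∂_u G(v, w) + ∂_v G(u, w) - ∂_w G(u, v))` at the point `y`. -/
def koszul (G : E → E →L[ℝ] E →L[ℝ] ℝ) (y : E) : E →L[ℝ] E →L[ℝ] E →L[ℝ] ℝ :=
  (1 / 2 : ℝ) • (fderiv ℝ G y + (fderiv ℝ G y).flip -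
    (ContinuousLinearMap.flipₗᵢ ℝ E E ℝ).toContinuousLinearEquiv.toContinuousLinearMap.comp
      (fderiv ℝ G y).flip)

theorem koszul_apply (G : E → E →L[ℝ] E →L[ℝ] ℝ) (y u v w : E) :
    koszul G y u v w =
      (1 / 2 : ℝ) * (fderiv ℝ G y u v w + fderiv ℝ G y v u w - fderiv ℝ G y w u v) := by
  simp [koszul]

/-- The Christoffel symbol `Γ(u, v)` at `y` of a field `G` of nondegenerate bilinear forms on `E`:
the vector with `G(Γ(u, v), w) = ½ (∂_u G(v, w) + ∂_v G(u, w) - ∂_w G(u, v))` for all `w`.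
It is the value at `y` of the Levi-Civita derivative `∇_u v` of the constant fields `u`, `v`. -/
def christoffel (G : E → E →L[ℝ] E →L[ℝ] ℝ) (y : E) : E →L[ℝ] E →L[ℝ] E :=
  (ContinuousLinearMap.compL ℝ E (E →L[ℝ] ℝ) E (ContinuousLinearMap.inverse (G y))).comp
    (koszul G y)

/-- The curvature tensor `R(u, v) w = ∇_u ∇_v w - ∇_v ∇_u w` at `y`, for constant vector fields
`u`, `v`, `w` on `E` (whose Lie brackets vanish). -/
def curvature (G : E → E →L[ℝ] E →L[ℝ] ℝ) (y u v w : E) : E :=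
  fderiv ℝ (christoffel G) y u v w - fderiv ℝ (christoffel G) y v u w +
    christoffel G y u (christoffel G y v w) - christoffel G y v (christoffel G y u w)

/-- The Ricci tensor of `G` at `y`: `Ric(u, w)` is the trace of `v ↦ R(v, u) w`. -/
def ricci (G : E → E →L[ℝ] E →L[ℝ] ℝ) (y u w : E) : ℝ :=
  LinearMap.trace ℝ E
    { toFun := fun v => curvature G y v u w
      map_add' := by intro a b; simp [curvature]; abel
      map_smul' := by intro c a; simp [curvature, smul_sub, smul_add] }

end Local

/-- A smooth Lorentz metric of signature `(-, +, …, +)` on a manifold `M` modelled on `E`: a smooth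
field of symmetric bilinear forms on the tangent spaces, such that each tangent space has a
vector `e` with `⟨e, e⟩ < 0` on whose orthogonal complement the form is positive definite. -/
structure LorentzMetric (E : Type*) [NormedAddCommGroup E] [NormedSpace ℝ E]
    (M : Type*) [TopologicalSpace M] [ChartedSpace E M] [IsManifold 𝓘(ℝ, E) ∞ M] where
  inner (x : M) : TangentSpace 𝓘(ℝ, E) x →L[ℝ] TangentSpace 𝓘(ℝ, E) x →L[ℝ] ℝ
  symm (x : M) (u v : TangentSpace 𝓘(ℝ, E) x) : inner x u v = inner x v u
  signature (x : M) : ∃ e : TangentSpace 𝓘(ℝ, E) x, inner x e e < 0 ∧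
    ∀ v : TangentSpace 𝓘(ℝ, E) x, inner x e v = 0 → v ≠ 0 → 0 < inner x v v
  contMDiff : ContMDiff 𝓘(ℝ, E) (𝓘(ℝ, E).prod 𝓘(ℝ, E →L[ℝ] E →L[ℝ] ℝ)) ∞
    (fun x ↦ Bundle.TotalSpace.mk' (E →L[ℝ] E →L[ℝ] ℝ)
      (E := fun x : M ↦ TangentSpace 𝓘(ℝ, E) x →L[ℝ] TangentSpace 𝓘(ℝ, E) x →L[ℝ] ℝ) x (inner x))

section Manifold

variable {E : Type*} [NormedAddCommGroup E] [NormedSpace ℝ E]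
  {M : Type*} [TopologicalSpace M] [ChartedSpace E M] [IsManifold 𝓘(ℝ, E) ∞ M]

/-- The metric read in a chart `e`: the pullback of `g` under `e.symm`, on the target of `e`. -/
def LorentzMetric.inChart (g : LorentzMetric E M) (e : OpenPartialHomeomorph M E) (y : E) :
    E →L[ℝ] E →L[ℝ] ℝ :=
  let L : E →L[ℝ] E := mfderiv 𝓘(ℝ, E) 𝓘(ℝ, E) e.symm y
  let B : E →L[ℝ] E →L[ℝ] ℝ := g.inner (e.symm y)
  B.bilinearComp L L

/-- The Ricci tensor of the metric `g` at `p`, computed in the preferred chart at `p`. -/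
def LorentzMetric.ricciTensor (g : LorentzMetric E M) (p : M)
    (u v : TangentSpace 𝓘(ℝ, E) p) : ℝ :=
  ricci (g.inChart (chartAt E p)) (chartAt E p p)
    (mfderiv 𝓘(ℝ, E) 𝓘(ℝ, E) (chartAt E p) p u) (mfderiv 𝓘(ℝ, E) 𝓘(ℝ, E) (chartAt E p) p v)

/-- `γ : ℝ → M` is a (complete, affinely parametrized) geodesic of `g`: it is smooth, and for every
`t` its coordinate expression `c` in the preferred chart at `γ t` satisfies the geodesic equation
`c'' + Γ(c', c') = 0` at the time `t`. -/
def LorentzMetric.IsCompleteGeodesic (g : LorentzMetric E M) (γ : ℝ → M) : Prop :=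
  ContMDiff 𝓘(ℝ, ℝ) 𝓘(ℝ, E) ∞ γ ∧
    ∀ t : ℝ,
      let c : ℝ → E := fun s => chartAt E (γ t) (γ s)
      deriv (deriv c) t +
        christoffel (g.inChart (chartAt E (γ t))) (c t) (deriv c t) (deriv c t) = 0

/-- The velocity `γ'(t)` is a timelike vector for every `t`. -/
def LorentzMetric.IsTimelike (g : LorentzMetric E M) (γ : ℝ → M) : Prop :=
  ∀ t : ℝ, g.inner (γ t) (mfderiv 𝓘(ℝ, ℝ) 𝓘(ℝ, E) γ t (1 : ℝ))
    (mfderiv 𝓘(ℝ, ℝ) 𝓘(ℝ, E) γ t (1 : ℝ)) < 0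

/-- A spacetime is viable if it admits a complete timelike geodesic. -/
def LorentzMetric.IsViable (g : LorentzMetric E M) : Prop :=
  ∃ γ : ℝ → M, g.IsCompleteGeodesic γ ∧ g.IsTimelike γ

variable {F : Type*} [NormedAddCommGroup F] [NormedSpace ℝ F]
  {N : Type*} [TopologicalSpace N] [ChartedSpace F N] [IsManifold 𝓘(ℝ, F) ∞ N]

/-- `φ` is conformal: `φ^* h = e^{2σ} g` for a smooth function `σ` on `M`. -/
def IsConformal (g : LorentzMetric E M) (h : LorentzMetric F N)
    (φ : M ≃ₘ^∞⟮𝓘(ℝ, E), 𝓘(ℝ, F)⟯ N) : Prop :=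
  ∃ σ : M → ℝ, ContMDiff 𝓘(ℝ, E) 𝓘(ℝ, ℝ) ∞ σ ∧
    ∀ (p : M) (u v : TangentSpace 𝓘(ℝ, E) p),
      h.inner (φ p) (mfderiv 𝓘(ℝ, E) 𝓘(ℝ, F) φ p u) (mfderiv 𝓘(ℝ, E) 𝓘(ℝ, F) φ p v) =
        Real.exp (2 * σ p) * g.inner p u v

/-- `φ` preserves the Ricci tensor: `φ^* Ric_h = Ric_g`. -/
def PreservesRicci (g : LorentzMetric E M) (h : LorentzMetric F N)
    (φ : M ≃ₘ^∞⟮𝓘(ℝ, E), 𝓘(ℝ, F)⟯ N) : Prop :=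
  ∀ (p : M) (u v : TangentSpace 𝓘(ℝ, E) p),
    h.ricciTensor (φ p) (mfderiv 𝓘(ℝ, E) 𝓘(ℝ, F) φ p u) (mfderiv 𝓘(ℝ, E) 𝓘(ℝ, F) φ p v) =
      g.ricciTensor p u v

/-- `φ` is a homothety: `φ^* h = c g` for a constant `c > 0`. -/
def IsHomothety (g : LorentzMetric E M) (h : LorentzMetric F N)
    (φ : M ≃ₘ^∞⟮𝓘(ℝ, E), 𝓘(ℝ, F)⟯ N) : Prop :=
  ∃ c : ℝ, 0 < c ∧ ∀ (p : M) (u v : TangentSpace 𝓘(ℝ, E) p),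
    h.inner (φ p) (mfderiv 𝓘(ℝ, E) 𝓘(ℝ, F) φ p u) (mfderiv 𝓘(ℝ, E) 𝓘(ℝ, F) φ p v) =
      c * g.inner p u v

end Manifold

end Spacetime

end

open scoped Manifold ContDiff

noncomputable section

namespace Spacetime

open Set Filter Topology

/-! ### Levi-Civita calculus for a metric on an open subset of a vector space. -/

section

variable {E : Type*} [NormedAddCommGroup E] [NormedSpace ℝ E]
variable {F : Type*} [NormedAddCommGroup F] [NormedSpace ℝ F]
variable {X : Type*} [NormedAddCommGroup X] [NormedSpace ℝ X]

/-! Write `φ^* h = e^{2σ} g` and `n = dim M`. The conformal change formula for the Ricci tensor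
(`ricci_conformal`) turns equality of the Ricci tensors into an equation relating `∇²σ`, `dσ ⊗ dσ`,
`|dσ|² g` and `Δσ g`. Its trace gives `Δσ = -(n - 2)|dσ|²/2`, and as `n > 2` there remains `∇²σ = dσ
⊗ dσ - ½|dσ|² g` (`hess_of_ricci_eq`). Equivalently `f = e^{-σ}` satisfies `∇²f = λ g` with `λ =
e^{-σ}|dσ|²/2`, and this `λ` is locally constant (`fderiv_concircularFactor`), hence constant on the
connected manifold.

Along a complete timelike geodesic `γ` the number `k = g(γ', γ')` is a negative constant, so `(f ∘
γ)'' = λk` and `f ∘ γ` is a polynomial of degree at most 2, positive on all of `ℝ`. Its discriminant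
is `(f ∘ γ)'² - 2fλk`, which the reverse Cauchy-Schwarz inequality for `grad σ` and `γ'` makes
nonnegative. A positive quadratic polynomial has negative discriminant, so `λ = 0` and `f ∘ γ` is
constant (`eq_zero_of_pos_of_second_deriv`). Thus at `γ 0` the gradient of `σ` is null and
orthogonal to a timelike vector, hence zero.

With `λ = 0` the equation reads `∇²σ = dσ ⊗ dσ`; along segments in charts Grönwall's inequality
propagates the zero of `dσ` (`fderiv_eq_zero_of_hess_eq`), and connectedness makes `σ` constant. If
`N` is the viable side, the argument is applied to `φ⁻¹`. -/

theorem fderiv_clm_apply_apply {c : X → E →L[ℝ] F} {u : X → E} {x : X}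
    (hc : DifferentiableAt ℝ c x) (hu : DifferentiableAt ℝ u x) (v : X) :
    fderiv ℝ (fun y => c y (u y)) x v = fderiv ℝ c x v (u x) + c x (fderiv ℝ u x v) := by
  rw [fderiv_clm_apply hc hu]; simp [add_comm]

theorem differentiableAt_clm_apply_const {c : X → E →L[ℝ] F} {x : X}
    (hc : DifferentiableAt ℝ c x) (u : E) : DifferentiableAt ℝ (fun y => c y u) x :=
  hc.clm_apply (differentiableAt_const u)

theorem fderiv_clm_apply_const {c : X → E →L[ℝ] F} {x : X}
    (hc : DifferentiableAt ℝ c x) (u : E) (v : X) :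
    fderiv ℝ (fun y => c y u) x v = fderiv ℝ c x v u := by
  rw [fderiv_clm_apply_apply hc (differentiableAt_const u)]; simp

theorem fderiv_clm_apply₂_apply {E' : Type*} [NormedAddCommGroup E'] [NormedSpace ℝ E']
    {c : X → E →L[ℝ] E' →L[ℝ] F} {u : X → E} {w : X → E'} {x : X}
    (hc : DifferentiableAt ℝ c x) (hu : DifferentiableAt ℝ u x) (hw : DifferentiableAt ℝ w x)
    (v : X) :
    fderiv ℝ (fun y => c y (u y) (w y)) x v =
      fderiv ℝ c x v (u x) (w x) + c x (fderiv ℝ u x v) (w x) + c x (u x) (fderiv ℝ w x v) := by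
  rw [fderiv_clm_apply_apply (hc.clm_apply hu) hw, fderiv_clm_apply_apply hc hu]; simp

/-- `G` is a smooth field of symmetric nondegenerate bilinear forms on the open set `U`. -/
structure IsMetricOn (G : E → E →L[ℝ] E →L[ℝ] ℝ) (U : Set E) : Prop where
  isOpen : IsOpen U
  contDiffOn : ContDiffOn ℝ ∞ G U
  symm : ∀ y ∈ U, ∀ u v, G y u v = G y v u
  nondeg : ∀ y ∈ U, ∀ u, (∀ v, G y u v = 0) → u = 0

theorem contDiffAt_fderiv {f : E → F} {y : E} (hf : ContDiffAt ℝ ∞ f y) :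
    ContDiffAt ℝ ∞ (fderiv ℝ f) y := hf.fderiv_right (by simp)

namespace IsMetricOn

variable {G : E → E →L[ℝ] E →L[ℝ] ℝ} {U : Set E} {y : E}

theorem mono (hG : IsMetricOn G U) {V : Set E} (hV : IsOpen V) (h : V ⊆ U) : IsMetricOn G V :=
  ⟨hV, hG.contDiffOn.mono h, fun y hy => hG.symm y (h hy), fun y hy => hG.nondeg y (h hy)⟩

theorem contDiffAt (hG : IsMetricOn G U) (hy : y ∈ U) : ContDiffAt ℝ ∞ G y :=
  hG.contDiffOn.contDiffAt (hG.isOpen.mem_nhds hy)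

theorem differentiableAt (hG : IsMetricOn G U) (hy : y ∈ U) : DifferentiableAt ℝ G y :=
  (hG.contDiffAt hy).differentiableAt (by simp)

theorem fderiv_symm (hG : IsMetricOn G U) (hy : y ∈ U) (w u v : E) :
    fderiv ℝ G y w u v = fderiv ℝ G y w v u := by
  have h := hG.differentiableAt hy
  rw [← fderiv_clm_apply_const h, ← fderiv_clm_apply_const h,
    ← fderiv_clm_apply_const (h.clm_apply (differentiableAt_const u)),
    ← fderiv_clm_apply_const (h.clm_apply (differentiableAt_const v))]
  refine congrArg (fun L : E →L[ℝ] ℝ => L w) (EventuallyEq.fderiv_eq ?_)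
  filter_upwards [hG.isOpen.mem_nhds hy] with z hz using hG.symm z hz u v

theorem eq_of_forall (hG : IsMetricOn G U) (hy : y ∈ U) {u v : E}
    (h : ∀ w, G y u w = G y v w) : u = v :=
  sub_eq_zero.1 (hG.nondeg y hy _ fun w => by simp [h w])

variable [FiniteDimensional ℝ E]

/-- `ContinuousLinearMap.inverse` has the junk value 0 off the invertible maps; this lemma gives
`christoffel` and `grad` their intended meaning. -/
theorem isInvertible (hG : IsMetricOn G U) (hy : y ∈ U) : (G y).IsInvertible := by
  have hinj : Function.Injective (G y : E →ₗ[ℝ] E →L[ℝ] ℝ) := by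
    rw [← LinearMap.ker_eq_bot, LinearMap.ker_eq_bot']
    intro u hu
    exact hG.nondeg y hy u fun v => by
      have := congrArg (fun L : E →L[ℝ] ℝ => L v) hu
      simpa using this
  have hdim : Module.finrank ℝ E = Module.finrank ℝ (E →L[ℝ] ℝ) := by
    rw [← (LinearMap.toContinuousLinearMap (𝕜 := ℝ) (E := E) (F' := ℝ)).finrank_eq]
    exact (Subspace.dual_finrank_eq (K := ℝ) (V := E)).symm
  exact ⟨(LinearEquiv.ofInjectiveOfFinrankEq (G y : E →ₗ[ℝ] E →L[ℝ] ℝ) hinj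
    hdim).toContinuousLinearEquiv, by ext; rfl⟩

theorem apply_inverse (hG : IsMetricOn G U) (hy : y ∈ U) (a : E →L[ℝ] ℝ) (w : E) :
    G y ((G y).inverse a) w = a w := by
  rw [(hG.isInvertible hy).self_apply_inverse]

theorem apply_christoffel (hG : IsMetricOn G U) (hy : y ∈ U) (u v w : E) :
    G y (christoffel G y u v) w =
      (1 / 2 : ℝ) * (fderiv ℝ G y u v w + fderiv ℝ G y v u w - fderiv ℝ G y w u v) := by
  rw [← koszul_apply]
  exact hG.apply_inverse hy (koszul G y u v) w

theorem christoffel_symm (hG : IsMetricOn G U) (hy : y ∈ U) (u v : E) :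
    christoffel G y u v = christoffel G y v u :=
  hG.eq_of_forall hy fun w => by
    rw [hG.apply_christoffel hy, hG.apply_christoffel hy, hG.fderiv_symm hy w u v]; ring

/-- Compatibility of the connection with the metric, `∇G = 0`, in coordinates. -/
theorem fderiv_apply (hG : IsMetricOn G U) (hy : y ∈ U) (v u w : E) :
    fderiv ℝ G y v u w = G y (christoffel G y v u) w + G y u (christoffel G y v w) := by
  rw [hG.symm y hy u, hG.apply_christoffel hy, hG.apply_christoffel hy, hG.fderiv_symm hy v w u,
    hG.fderiv_symm hy u v w]
  ring

theorem contDiffAt_inverse (hG : IsMetricOn G U) (hy : y ∈ U) :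
    ContDiffAt ℝ ∞ (fun z => (G z).inverse) y :=
  have := FiniteDimensional.complete ℝ E
  (hG.isInvertible hy).contDiffAt_map_inverse.comp y (hG.contDiffAt hy)

theorem contDiffAt_christoffel (hG : IsMetricOn G U) (hy : y ∈ U) :
    ContDiffAt ℝ ∞ (christoffel G) y := by
  have h1 := contDiffAt_fderiv (hG.contDiffAt hy)
  have hflip : ContDiffAt ℝ ∞ (fun z => (fderiv ℝ G z).flip) y :=
    (ContinuousLinearMap.flipₗᵢ ℝ E E (E →L[ℝ] ℝ)).contDiff.contDiffAt.comp y h1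
  have hk : ContDiffAt ℝ ∞ (koszul G) y := by
    unfold koszul
    exact (contDiffAt_const (c := (1 / 2 : ℝ))).smul ((h1.add hflip).sub (contDiffAt_const.clm_comp hflip))
  unfold christoffel
  exact (((ContinuousLinearMap.compL ℝ E (E →L[ℝ] ℝ) E).contDiff.contDiffAt.comp y
    (hG.contDiffAt_inverse hy))).clm_comp hk

theorem differentiableAt_christoffel (hG : IsMetricOn G U) (hy : y ∈ U) :
    DifferentiableAt ℝ (christoffel G) y :=
  (hG.contDiffAt_christoffel hy).differentiableAt (by simp)

end IsMetricOn

/-- The endomorphism `v ↦ R(v, u) w`, whose trace is the Ricci tensor. -/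
def curvatureEnd (G : E → E →L[ℝ] E →L[ℝ] ℝ) (y u w : E) : E →ₗ[ℝ] E where
  toFun := fun v => curvature G y v u w
  map_add' := by intro a b; simp [curvature]; abel
  map_smul' := by intro c a; simp [curvature, smul_sub, smul_add]

theorem ricci_eq (G : E → E →L[ℝ] E →L[ℝ] ℝ) (y u w : E) :
    ricci G y u w = LinearMap.trace ℝ E (curvatureEnd G y u w) := rfl

theorem fderiv_fderiv_symm {f : E → F} {y : E} (hf : ContDiffAt ℝ ∞ f y) (u v : E) :
    fderiv ℝ (fderiv ℝ f) y u v = fderiv ℝ (fderiv ℝ f) y v u :=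
  (hf.isSymmSndFDerivAt (by simpa using WithTop.coe_le_coe.2 (le_top : (2 : ℕ∞) ≤ ⊤))).eq u v

/-! ### Naturality of connection, curvature and Ricci tensor under local diffeomorphisms. -/

section Naturality

variable {G : E → E →L[ℝ] E →L[ℝ] ℝ} {U : Set E} {H : F → F →L[ℝ] F →L[ℝ] ℝ} {V : Set F}
  {Φ : E → F} {y : E}

theorem fderiv_pullback (hH : IsMetricOn H V) (hU : IsOpen U)
    (hΦ : ContDiffOn ℝ ∞ Φ U) (hUV : MapsTo Φ U V)
    (hGH : ∀ y ∈ U, ∀ u v, G y u v = H (Φ y) (fderiv ℝ Φ y u) (fderiv ℝ Φ y v))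
    (hG : IsMetricOn G U) (hy : y ∈ U) (w u v : E) :
    fderiv ℝ G y w u v = fderiv ℝ H (Φ y) (fderiv ℝ Φ y w) (fderiv ℝ Φ y u) (fderiv ℝ Φ y v) +
      H (Φ y) (fderiv ℝ (fderiv ℝ Φ) y w u) (fderiv ℝ Φ y v) +
      H (Φ y) (fderiv ℝ Φ y u) (fderiv ℝ (fderiv ℝ Φ) y w v) := by
  have h := hG.differentiableAt hy
  have hΦy : ContDiffAt ℝ ∞ Φ y := hΦ.contDiffAt (hU.mem_nhds hy)
  have hd : DifferentiableAt ℝ Φ y := hΦy.differentiableAt (by simp)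
  have hD : DifferentiableAt ℝ (fderiv ℝ Φ) y :=
    (contDiffAt_fderiv hΦy).differentiableAt (by simp)
  have hH' := hH.differentiableAt (hUV hy)
  rw [← fderiv_clm_apply_const h,
    ← fderiv_clm_apply_const (h.clm_apply (differentiableAt_const u))]
  have e : (fun z => G z u v) =ᶠ[𝓝 y] fun z => (H ∘ Φ) z (fderiv ℝ Φ z u) (fderiv ℝ Φ z v) := by
    filter_upwards [hU.mem_nhds hy] with z hz using hGH z hz u v
  rw [e.fderiv_eq, fderiv_clm_apply₂_apply (hH'.comp y hd)
    (hD.clm_apply (differentiableAt_const u)) (hD.clm_apply (differentiableAt_const v)),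
    fderiv_clm_apply_const hD, fderiv_clm_apply_const hD, fderiv_comp y hH' hd]
  rfl

variable [FiniteDimensional ℝ E] [FiniteDimensional ℝ F]

/-- In the Koszul combination of the derivatives of the pullback, the second derivatives of `Φ`
cancel except for one inhomogeneous term. Surjectivity of `DΦ` supplies enough test vectors for
nondegeneracy of `H`. -/
theorem map_christoffel (hH : IsMetricOn H V) (hU : IsOpen U)
    (hΦ : ContDiffOn ℝ ∞ Φ U) (hUV : MapsTo Φ U V)
    (hsurj : ∀ y ∈ U, Function.Surjective (fderiv ℝ Φ y))
    (hGH : ∀ y ∈ U, ∀ u v, G y u v = H (Φ y) (fderiv ℝ Φ y u) (fderiv ℝ Φ y v))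
    (hG : IsMetricOn G U) (hy : y ∈ U) (u v : E) :
    fderiv ℝ Φ y (christoffel G y u v) = fderiv ℝ (fderiv ℝ Φ) y u v +
      christoffel H (Φ y) (fderiv ℝ Φ y u) (fderiv ℝ Φ y v) := by
  have hΦy : ContDiffAt ℝ ∞ Φ y := hΦ.contDiffAt (hU.mem_nhds hy)
  refine hH.eq_of_forall (hUV hy) fun w' => ?_
  obtain ⟨w, rfl⟩ := hsurj y hy w'
  rw [← hGH y hy, hG.apply_christoffel hy, map_add, add_apply,
    hH.apply_christoffel (hUV hy)]
  simp only [fderiv_pullback hH hU hΦ hUV hGH hG hy]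
  rw [hH.symm _ (hUV hy) (fderiv ℝ Φ y v), fderiv_fderiv_symm hΦy v u,
    fderiv_fderiv_symm hΦy w u, fderiv_fderiv_symm hΦy w v,
    hH.symm _ (hUV hy) (fderiv ℝ Φ y u)]
  ring

/-- Differentiating the transformation law of `christoffel` produces second and third derivatives of
`Φ`; being symmetric, they cancel on antisymmetrizing in `u`, `v`. -/
theorem map_curvature (hH : IsMetricOn H V) (hU : IsOpen U)
    (hΦ : ContDiffOn ℝ ∞ Φ U) (hUV : MapsTo Φ U V)
    (hsurj : ∀ y ∈ U, Function.Surjective (fderiv ℝ Φ y))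
    (hGH : ∀ y ∈ U, ∀ u v, G y u v = H (Φ y) (fderiv ℝ Φ y u) (fderiv ℝ Φ y v))
    (hG : IsMetricOn G U) (hy : y ∈ U) (u v w : E) :
    fderiv ℝ Φ y (curvature G y u v w) =
      curvature H (Φ y) (fderiv ℝ Φ y u) (fderiv ℝ Φ y v) (fderiv ℝ Φ y w) := by
  have hΦy : ContDiffAt ℝ ∞ Φ y := hΦ.contDiffAt (hU.mem_nhds hy)
  have hd : DifferentiableAt ℝ Φ y := hΦy.differentiableAt (by simp)
  have hD : DifferentiableAt ℝ (fderiv ℝ Φ) y :=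
    (contDiffAt_fderiv hΦy).differentiableAt (by simp)
  have hD2 : DifferentiableAt ℝ (fderiv ℝ (fderiv ℝ Φ)) y :=
    (contDiffAt_fderiv (contDiffAt_fderiv hΦy)).differentiableAt (by simp)
  have hΓ := hG.differentiableAt_christoffel hy
  have hΓH := hH.differentiableAt_christoffel (hUV hy)
  have hΓ' := map_christoffel hH hU hΦ hUV hsurj hGH hG hy
  have key : ∀ a b c : E, fderiv ℝ (fderiv ℝ Φ) y a (christoffel G y b c) +
      fderiv ℝ Φ y (fderiv ℝ (christoffel G) y a b c) =
      fderiv ℝ (fderiv ℝ (fderiv ℝ Φ)) y a b c +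
      (fderiv ℝ (christoffel H) (Φ y) (fderiv ℝ Φ y a) (fderiv ℝ Φ y b) (fderiv ℝ Φ y c) +
      christoffel H (Φ y) (fderiv ℝ (fderiv ℝ Φ) y a b) (fderiv ℝ Φ y c) +
      christoffel H (Φ y) (fderiv ℝ Φ y b) (fderiv ℝ (fderiv ℝ Φ) y a c)) := by
    intro a b c
    have e : (fun z => fderiv ℝ Φ z (christoffel G z b c)) =ᶠ[𝓝 y]
        fun z => fderiv ℝ (fderiv ℝ Φ) z b c +
          (christoffel H ∘ Φ) z (fderiv ℝ Φ z b) (fderiv ℝ Φ z c) := by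
      filter_upwards [hU.mem_nhds hy] with z hz
        using map_christoffel hH hU hΦ hUV hsurj hGH hG hz b c
    have e' := congrArg (fun L : E →L[ℝ] F => L a) e.fderiv_eq
    rw [fderiv_clm_apply_apply hD (differentiableAt_clm_apply_const (differentiableAt_clm_apply_const hΓ b) c), fderiv_clm_apply_const (differentiableAt_clm_apply_const hΓ b),
      fderiv_clm_apply_const hΓ, fderiv_fun_add (differentiableAt_clm_apply_const (differentiableAt_clm_apply_const hD2 b) c)
      (((hΓH.comp y hd).clm_apply (differentiableAt_clm_apply_const hD b)).clm_apply (differentiableAt_clm_apply_const hD c)), add_apply,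
      fderiv_clm_apply_const (differentiableAt_clm_apply_const hD2 b), fderiv_clm_apply_const hD2,
      fderiv_clm_apply₂_apply (hΓH.comp y hd) (differentiableAt_clm_apply_const hD b) (differentiableAt_clm_apply_const hD c), fderiv_clm_apply_const hD,
      fderiv_clm_apply_const hD, fderiv_comp y hΓH hd] at e'
    exact e'
  have k1 := eq_sub_of_add_eq' (key u v w)
  have k2 := eq_sub_of_add_eq' (key v u w)
  simp only [curvature, map_add, map_sub, k1, k2, hΓ', fderiv_fderiv_symm hΦy v u,
    fderiv_fderiv_symm (contDiffAt_fderiv hΦy) v u]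
  abel

theorem ricci_pullback (hH : IsMetricOn H V) (hU : IsOpen U)
    (hΦ : ContDiffOn ℝ ∞ Φ U) (hUV : MapsTo Φ U V)
    (hbij : ∀ y ∈ U, Function.Bijective (fderiv ℝ Φ y))
    (hGH : ∀ y ∈ U, ∀ u v, G y u v = H (Φ y) (fderiv ℝ Φ y u) (fderiv ℝ Φ y v))
    (hG : IsMetricOn G U) (hy : y ∈ U) (u w : E) :
    ricci G y u w = ricci H (Φ y) (fderiv ℝ Φ y u) (fderiv ℝ Φ y w) := by
  let e : E ≃ₗ[ℝ] F := LinearEquiv.ofBijective (fderiv ℝ Φ y : E →ₗ[ℝ] F) (hbij y hy)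
  have he : ∀ x, e x = fderiv ℝ Φ y x := fun _ => rfl
  rw [ricci_eq, ricci_eq, ← LinearMap.trace_conj' _ e]
  congr 1
  ext v
  rw [LinearEquiv.conj_apply_apply, he]
  refine (map_curvature hH hU hΦ hUV (fun y hy => (hbij y hy).2) hGH hG hy (e.symm v) u w).trans ?_
  rw [← he (e.symm v), e.apply_symm_apply]
  rfl

end Naturality

end

/-! ### Conformal change of the metric and the Hessian equation for `σ`. -/

section

variable {E : Type*} [NormedAddCommGroup E] [NormedSpace ℝ E]

/-- The gradient of `σ` with respect to the metric `G`. -/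
def grad (G : E → E →L[ℝ] E →L[ℝ] ℝ) (σ : E → ℝ) (y : E) : E := (G y).inverse (fderiv ℝ σ y)

/-- The Hessian `∇²σ` with respect to the metric `G`. -/
def hess (G : E → E →L[ℝ] E →L[ℝ] ℝ) (σ : E → ℝ) (y : E) : E →L[ℝ] E →L[ℝ] ℝ :=
  fderiv ℝ (fderiv ℝ σ) y -
    (ContinuousLinearMap.compL ℝ E E ℝ (fderiv ℝ σ y)).comp (christoffel G y)

theorem hess_apply (G : E → E →L[ℝ] E →L[ℝ] ℝ) (σ : E → ℝ) (y u v : E) :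
    hess G σ y u v = fderiv ℝ (fderiv ℝ σ) y u v - fderiv ℝ σ y (christoffel G y u v) := by
  simp [hess]

/-- The covariant derivative `v ↦ ∇_v grad σ`. -/
def covDerivGrad (G : E → E →L[ℝ] E →L[ℝ] ℝ) (σ : E → ℝ) (y : E) : E →L[ℝ] E :=
  fderiv ℝ (grad G σ) y + (christoffel G y).flip (grad G σ y)

theorem covDerivGrad_apply (G : E → E →L[ℝ] E →L[ℝ] ℝ) (σ : E → ℝ) (y v : E) :
    covDerivGrad G σ y v = fderiv ℝ (grad G σ) y v + christoffel G y v (grad G σ y) := by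
  simp [covDerivGrad]

variable [FiniteDimensional ℝ E] {G G' : E → E →L[ℝ] E →L[ℝ] ℝ} {σ : E → ℝ} {U : Set E} {y : E}

namespace IsMetricOn

theorem apply_grad (hG : IsMetricOn G U) (hy : y ∈ U) (w : E) :
    G y (grad G σ y) w = fderiv ℝ σ y w := hG.apply_inverse hy _ w

theorem apply_grad' (hG : IsMetricOn G U) (hy : y ∈ U) (w : E) :
    G y w (grad G σ y) = fderiv ℝ σ y w := by rw [hG.symm y hy, hG.apply_grad hy]

theorem differentiableAt_grad (hG : IsMetricOn G U) (hy : y ∈ U) (hσ : ContDiffAt ℝ ∞ σ y) :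
    DifferentiableAt ℝ (grad G σ) y :=
  (((hG.contDiffAt_inverse hy).clm_apply (contDiffAt_fderiv hσ))).differentiableAt (by simp)

/-- Differentiate `G(grad σ, w) = dσ(w)` and use `∇G = 0`. The Hessian with an index raised is thus
an endomorphism, whose trace is the Laplacian of `σ`. -/
theorem apply_covDerivGrad (hG : IsMetricOn G U) (hσ : ContDiffOn ℝ ∞ σ U) (hy : y ∈ U) (u w : E) :
    G y (covDerivGrad G σ y u) w = hess G σ y u w := by
  have hσy := hσ.contDiffAt (hG.isOpen.mem_nhds hy)
  have hD := (contDiffAt_fderiv hσy).differentiableAt (by simp)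
  have e : (fun z => G z (grad G σ z) w) =ᶠ[𝓝 y] fun z => fderiv ℝ σ z w := by
    filter_upwards [hG.isOpen.mem_nhds hy] with z hz using hG.apply_grad hz w
  have e' := congrArg (fun L : E →L[ℝ] ℝ => L u) e.fderiv_eq
  rw [fderiv_clm_apply₂_apply (hG.differentiableAt hy) (hG.differentiableAt_grad hy hσy)
    (differentiableAt_const w), fderiv_clm_apply_const hD, hG.fderiv_apply hy,
    hG.apply_grad hy] at e'
  simp only [fderiv_fun_const, Pi.zero_apply, zero_apply, map_zero, add_zero] at e'
  rw [covDerivGrad_apply, hess_apply, map_add, add_apply]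
  linarith

end IsMetricOn

section Conformal

theorem christoffel_conformal (hG : IsMetricOn G U) (hG' : IsMetricOn G' U)
    (hσ : ContDiffOn ℝ ∞ σ U)
    (hc : ∀ y ∈ U, ∀ u v, G' y u v = Real.exp (2 * σ y) * G y u v) (hy : y ∈ U) (u v : E) :
    christoffel G' y u v = christoffel G y u v + fderiv ℝ σ y u • v + fderiv ℝ σ y v • u -
      G y u v • grad G σ y := by
  have hσy := (hσ.contDiffAt (hG.isOpen.mem_nhds hy)).differentiableAt (by simp)
  have hd := hG.differentiableAt hy
  have hd' := hG'.differentiableAt hy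
  have key : ∀ a b c, fderiv ℝ G' y a b c =
      Real.exp (2 * σ y) * (2 * fderiv ℝ σ y a * G y b c + fderiv ℝ G y a b c) := by
    intro a b c
    have e : (fun z => G' z b c) =ᶠ[𝓝 y] fun z => Real.exp (2 * σ z) * G z b c := by
      filter_upwards [hG.isOpen.mem_nhds hy] with z hz using hc z hz b c
    have e' := congrArg (fun L : E →L[ℝ] ℝ => L a) e.fderiv_eq
    have hs : DifferentiableAt ℝ (fun z => 2 * σ z) y := hσy.const_mul 2
    rw [fderiv_clm_apply_const (differentiableAt_clm_apply_const hd' b),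
      fderiv_clm_apply_const hd',
      fderiv_fun_mul hs.exp (differentiableAt_clm_apply_const
        (differentiableAt_clm_apply_const hd b) c), fderiv_exp hs, fderiv_const_mul hσy] at e'
    rw [e', add_apply, smul_apply,
      fderiv_clm_apply_const (differentiableAt_clm_apply_const hd b), fderiv_clm_apply_const hd]
    simp
    ring
  refine hG'.eq_of_forall hy fun w => ?_
  rw [hG'.apply_christoffel hy, key, key, key, hc y hy]
  simp only [map_add, map_sub, map_smul, add_apply, sub_apply, smul_apply,
    hG.apply_christoffel hy, hG.apply_grad hy, smul_eq_mul]
  ring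

theorem curvature_conformal (hG : IsMetricOn G U) (hG' : IsMetricOn G' U)
    (hσ : ContDiffOn ℝ ∞ σ U)
    (hc : ∀ y ∈ U, ∀ u v, G' y u v = Real.exp (2 * σ y) * G y u v) (hy : y ∈ U) (v u w : E) :
    curvature G' y v u w = curvature G y v u w + hess G σ y v w • u - hess G σ y u w • v
      - G y u w • covDerivGrad G σ y v + G y v w • covDerivGrad G σ y u
      + (fderiv ℝ σ y u * fderiv ℝ σ y w - fderiv ℝ σ y (grad G σ y) * G y u w) • v
      - (fderiv ℝ σ y w * fderiv ℝ σ y v - fderiv ℝ σ y (grad G σ y) * G y v w) • u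
      - (fderiv ℝ σ y u * G y v w - G y u w * fderiv ℝ σ y v) • grad G σ y := by
  have hσy := hσ.contDiffAt (hG.isOpen.mem_nhds hy)
  have hd := hG.differentiableAt hy
  have hΓ := hG.differentiableAt_christoffel hy
  have hA := hG.differentiableAt_grad hy hσy
  have hD : DifferentiableAt ℝ (fderiv ℝ σ) y :=
    (contDiffAt_fderiv hσy).differentiableAt (by simp)
  -- The derivative of `christoffel_conformal`, with `DG` already rewritten through the Christoffel
  -- symbols so that covariant derivatives can be assembled at the end.
  have key : ∀ a b c, fderiv ℝ (christoffel G') y a b c =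
      fderiv ℝ (christoffel G) y a b c + fderiv ℝ (fderiv ℝ σ) y a b • c +
        fderiv ℝ (fderiv ℝ σ) y a c • b -
        ((G y (christoffel G y a b) c + G y b (christoffel G y a c)) • grad G σ y +
          G y b c • fderiv ℝ (grad G σ) y a) := by
    intro a b c
    have e : (fun z => christoffel G' z b c) =ᶠ[𝓝 y] fun z => christoffel G z b c +
        fderiv ℝ σ z b • c + fderiv ℝ σ z c • b - G z b c • grad G σ z := by
      filter_upwards [hG.isOpen.mem_nhds hy] with z hz using
        christoffel_conformal hG hG' hσ hc hz b c
    have e' := congrArg (fun L : E →L[ℝ] E => L a) e.fderiv_eq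
    have d1 := differentiableAt_clm_apply_const (differentiableAt_clm_apply_const hΓ b) c
    have d2 := differentiableAt_clm_apply_const hD
    have d3 := differentiableAt_clm_apply_const (differentiableAt_clm_apply_const hd b) c
    rw [fderiv_clm_apply_const (differentiableAt_clm_apply_const
        (hG'.differentiableAt_christoffel hy) b),
      fderiv_clm_apply_const (hG'.differentiableAt_christoffel hy),
      fderiv_fun_sub ((d1.fun_add ((d2 b).smul_const c)).fun_add ((d2 c).smul_const b)) (d3.fun_smul hA),
      fderiv_fun_add (d1.fun_add ((d2 b).smul_const c)) ((d2 c).smul_const b),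
      fderiv_fun_add d1 ((d2 b).smul_const c), fderiv_smul_const (d2 b), fderiv_smul_const (d2 c),
      fderiv_fun_smul d3 hA] at e'
    rw [e']
    simp only [add_apply, sub_apply, smul_apply,
      ContinuousLinearMap.smulRight_apply,
      fderiv_clm_apply_const (differentiableAt_clm_apply_const hΓ b), fderiv_clm_apply_const hΓ,
      fderiv_clm_apply_const hD, hG.fderiv_apply hy,
      fderiv_clm_apply_const (differentiableAt_clm_apply_const hd b), fderiv_clm_apply_const hd]
    module
  simp only [curvature, key, christoffel_conformal hG hG' hσ hc hy, hess_apply,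
    covDerivGrad_apply, map_add, map_sub, map_smul, hG.apply_grad' hy, smul_eq_mul, hG.christoffel_symm hy u v,
    fderiv_fderiv_symm hσy u v, hG.symm y hy u v]
  module

theorem ricci_conformal (hG : IsMetricOn G U) (hG' : IsMetricOn G' U)
    (hσ : ContDiffOn ℝ ∞ σ U)
    (hc : ∀ y ∈ U, ∀ u v, G' y u v = Real.exp (2 * σ y) * G y u v) (hy : y ∈ U) (u w : E) :
    ricci G' y u w = ricci G y u w -
      (Module.finrank ℝ E - 2 : ℝ) * (hess G σ y u w - fderiv ℝ σ y u * fderiv ℝ σ y w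
        + fderiv ℝ σ y (grad G σ y) * G y u w) -
      LinearMap.trace ℝ E (covDerivGrad G σ y) * G y u w := by
  -- As endomorphisms in `v`, the correction terms are multiples of the identity, of `∇ grad σ`, or
  -- of rank one, so the trace can be read off term by term.
  have h : curvatureEnd G' y u w = curvatureEnd G y u w
      + ((hess G σ y).flip w : E →ₗ[ℝ] ℝ).smulRight u - hess G σ y u w • LinearMap.id
      - G y u w • (covDerivGrad G σ y : E →ₗ[ℝ] E)
      + ((G y).flip w : E →ₗ[ℝ] ℝ).smulRight (covDerivGrad G σ y u)
      + (fderiv ℝ σ y u * fderiv ℝ σ y w - fderiv ℝ σ y (grad G σ y) * G y u w) • LinearMap.id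
      - (fderiv ℝ σ y w • fderiv ℝ σ y - fderiv ℝ σ y (grad G σ y) • (G y).flip w :
          E →ₗ[ℝ] ℝ).smulRight u
      - (fderiv ℝ σ y u • (G y).flip w - G y u w • fderiv ℝ σ y :
          E →ₗ[ℝ] ℝ).smulRight (grad G σ y) := by
    ext v
    exact curvature_conformal hG hG' hσ hc hy v u w
  rw [ricci_eq, ricci_eq, h]
  simp only [map_add, map_sub, map_smul, LinearMap.trace_smulRight, LinearMap.trace_id]
  simp only [ContinuousLinearMap.coe_coe, ContinuousLinearMap.flip_apply, LinearMap.sub_apply,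
    LinearMap.smul_apply, smul_eq_mul, hG.apply_grad hy, hG.apply_covDerivGrad hσ hy]
  ring

theorem hess_of_ricci_eq (hn : 2 < Module.finrank ℝ E)
    (hG : IsMetricOn G U) (hG' : IsMetricOn G' U) (hσ : ContDiffOn ℝ ∞ σ U)
    (hc : ∀ y ∈ U, ∀ u v, G' y u v = Real.exp (2 * σ y) * G y u v)
    (hric : ∀ y ∈ U, ∀ u v, ricci G' y u v = ricci G y u v) (hy : y ∈ U) (u w : E) :
    hess G σ y u w = fderiv ℝ σ y u * fderiv ℝ σ y w -
      fderiv ℝ σ y (grad G σ y) / 2 * G y u w := by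
  set n : ℝ := (Module.finrank ℝ E : ℝ) with hn'
  have hn2 : 2 < n := by rw [hn']; exact_mod_cast hn
  set N := fderiv ℝ σ y (grad G σ y) with hN
  set Δ := LinearMap.trace ℝ E (covDerivGrad G σ y) with hΔ
  have h1 : ∀ u w, (n - 2) * (hess G σ y u w - fderiv ℝ σ y u * fderiv ℝ σ y w + N * G y u w) +
      Δ * G y u w = 0 := by
    intro u w
    have := ricci_conformal hG hG' hσ hc hy u w
    rw [hric y hy] at this
    linarith
  -- The first index of `h1` is raised in order to take the trace.
  have h2 : (n - 2) • ((covDerivGrad G σ y : E →ₗ[ℝ] E)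
      - (fderiv ℝ σ y : E →ₗ[ℝ] ℝ).smulRight (grad G σ y) + N • LinearMap.id) +
      Δ • LinearMap.id = 0 := by
    ext v
    refine hG.eq_of_forall hy fun w => ?_
    have := h1 v w
    rw [← hG.apply_covDerivGrad hσ hy, ← hG.apply_grad hy w] at this
    simpa [mul_add, mul_sub] using this
  have h3 := congrArg (LinearMap.trace ℝ E) h2
  simp only [map_add, map_sub, map_smul, LinearMap.trace_smulRight, LinearMap.trace_id, map_zero,
    smul_eq_mul, ← hΔ, ← hn', ContinuousLinearMap.coe_coe, ← hN] at h3
  have h4 : Δ = -((n - 2) * N / 2) := by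
    -- The trace reads `(2n - 2)Δ + (n - 2)(n - 1)N = 0`; the factor `n - 1` is nonzero.
    have : (n - 1) * (Δ - -((n - 2) * N / 2)) = 0 := by linear_combination h3 / 2
    rcases mul_eq_zero.1 this with h | h <;> linarith
  have h5 : (n - 2) * (hess G σ y u w - (fderiv ℝ σ y u * fderiv ℝ σ y w - N / 2 * G y u w)) = 0 := by
    have := h1 u w
    rw [h4] at this
    linear_combination this
  rcases mul_eq_zero.1 h5 with h | h <;> linarith

/-- The constant `λ = e^{-σ} |dσ|² / 2`. -/
def concircularFactor (G : E → E →L[ℝ] E →L[ℝ] ℝ) (σ : E → ℝ) (y : E) : ℝ :=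
  Real.exp (-σ y) * fderiv ℝ σ y (grad G σ y) / 2

/-- Contracting the Hessian equation with `grad σ` gives `d|dσ|² = |dσ|² dσ`, which the derivative
of `e^{-σ}` cancels. -/
theorem fderiv_concircularFactor (hG : IsMetricOn G U) (hσ : ContDiffOn ℝ ∞ σ U)
    (hh : ∀ y ∈ U, ∀ u w, hess G σ y u w = fderiv ℝ σ y u * fderiv ℝ σ y w -
      fderiv ℝ σ y (grad G σ y) / 2 * G y u w) (hy : y ∈ U) :
    HasFDerivAt (concircularFactor G σ) (0 : E →L[ℝ] ℝ) y := by
  have hσy := hσ.contDiffAt (hG.isOpen.mem_nhds hy)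
  have hs : DifferentiableAt ℝ (fun z => -σ z) y := (hσy.differentiableAt (by simp)).neg
  have hA := hG.differentiableAt_grad hy hσy
  have hD : DifferentiableAt ℝ (fderiv ℝ σ) y :=
    (contDiffAt_fderiv hσy).differentiableAt (by simp)
  have e : concircularFactor G σ = fun z =>
      (1 / 2 : ℝ) * (Real.exp (-σ z) * fderiv ℝ σ z (grad G σ z)) := by
    ext z; simp only [concircularFactor]; ring
  have hd : DifferentiableAt ℝ (concircularFactor G σ) y := by
    rw [e]
    exact (hs.exp.fun_mul (hD.clm_apply hA)).const_mul (1 / 2 : ℝ)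
  have : fderiv ℝ (concircularFactor G σ) y = 0 := by
    ext v
    rw [e, fderiv_const_mul (hs.exp.fun_mul (hD.clm_apply hA)),
      fderiv_fun_mul hs.exp (hD.clm_apply hA), fderiv_exp hs, fderiv_fun_neg]
    simp only [add_apply, smul_apply, neg_apply,
      smul_eq_mul, fderiv_clm_apply_apply hD hA, zero_apply]
    have h1 := hG.apply_covDerivGrad hσ hy v (grad G σ y)
    rw [hG.apply_grad' hy, covDerivGrad_apply, map_add, hess_apply] at h1
    have h2 := hh y hy v (grad G σ y)
    rw [hess_apply, hG.apply_grad' hy] at h2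
    linear_combination (1 / 2 : ℝ) * Real.exp (-σ y) * h1 + Real.exp (-σ y) * h2
  exact this ▸ hd.hasFDerivAt

end Conformal

end

/-! ### Lorentz metrics pulled back to open subsets of vector spaces. -/

section

variable {E : Type*} [NormedAddCommGroup E] [NormedSpace ℝ E]
  {F : Type*} [NormedAddCommGroup F] [NormedSpace ℝ F]
  {X : Type*} [NormedAddCommGroup X] [NormedSpace ℝ X]
  {M : Type*} [TopologicalSpace M] [ChartedSpace E M] [IsManifold 𝓘(ℝ, E) ∞ M]

theorem LorentzMetric.nondeg (g : LorentzMetric E M) (x : M) (u : TangentSpace 𝓘(ℝ, E) x)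
    (h : ∀ v, g.inner x u v = 0) : u = 0 := by
  obtain ⟨e, -, he'⟩ := g.signature x
  by_contra hu
  exact (he' u (by rw [g.symm, h]) hu).ne' (h u)

/-- The pullback of the metric `g` under a map `ψ : X → M`. -/
def LorentzMetric.pullback (g : LorentzMetric E M) (ψ : X → M) (y : X) : X →L[ℝ] X →L[ℝ] ℝ :=
  let L : X →L[ℝ] E := mfderiv 𝓘(ℝ, X) 𝓘(ℝ, E) ψ y
  let B : E →L[ℝ] E →L[ℝ] ℝ := g.inner (ψ y)
  B.bilinearComp L L

namespace LorentzMetric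

variable (g : LorentzMetric E M) {ψ ψ' : X → M} {y : X} {U : Set X}

theorem inChart_eq_pullback (e : OpenPartialHomeomorph M E) : g.inChart e = g.pullback e.symm := rfl

theorem pullback_apply (ψ : X → M) (y u v : X) : g.pullback ψ y u v =
    g.inner (ψ y) (mfderiv 𝓘(ℝ, X) 𝓘(ℝ, E) ψ y u) (mfderiv 𝓘(ℝ, X) 𝓘(ℝ, E) ψ y v) := rfl

theorem pullback_congr (h : ψ =ᶠ[𝓝 y] ψ') : g.pullback ψ y = g.pullback ψ' y := by
  have h1 : (mfderiv 𝓘(ℝ, X) 𝓘(ℝ, E) ψ y : X →L[ℝ] E) = mfderiv 𝓘(ℝ, X) 𝓘(ℝ, E) ψ' y :=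
    h.mfderiv_eq
  have h2 : (g.inner (ψ y) : E →L[ℝ] E →L[ℝ] ℝ) = g.inner (ψ' y) := by rw [h.eq_of_nhds]
  unfold pullback
  simp only
  rw [h1, h2]

theorem pullback_comp {X' : Type*} [NormedAddCommGroup X'] [NormedSpace ℝ X'] {k : X' → X}
    {z : X'} (hψ : MDifferentiableAt 𝓘(ℝ, X) 𝓘(ℝ, E) ψ (k z)) (hk : DifferentiableAt ℝ k z)
    (u v : X') :
    g.pullback (ψ ∘ k) z u v = g.pullback ψ (k z) (fderiv ℝ k z u) (fderiv ℝ k z v) := by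
  rw [pullback_apply, mfderiv_comp z hψ hk.mdifferentiableAt, mfderiv_eq_fderiv]
  rfl

theorem contDiffOn_pullback_apply (hU : IsOpen U)
    (hψ : ContMDiffOn 𝓘(ℝ, X) 𝓘(ℝ, E) ∞ ψ U) (u v : X) :
    ContDiffOn ℝ ∞ (fun y => g.pullback ψ y u v) U := by
  have hsec : ∀ u : X, ContMDiffOn 𝓘(ℝ, X) (𝓘(ℝ, E).prod 𝓘(ℝ, E)) ∞
      (fun y => Bundle.TotalSpace.mk' E (E := fun x : M => TangentSpace 𝓘(ℝ, E) x) (ψ y)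
        (mfderiv 𝓘(ℝ, X) 𝓘(ℝ, E) ψ y u)) U := by
    intro u
    have h1 : ContMDiff 𝓘(ℝ, X) 𝓘(ℝ, X).tangent ∞
        (fun y : X => (⟨y, u⟩ : TangentBundle 𝓘(ℝ, X) X)) := by
      intro y
      exact (contMDiffAt_vectorSpace_iff_contDiffAt (V := fun _ => u)).2 contDiffAt_const
    have h2 := (hψ.contMDiffOn_tangentMapWithin (m := ∞) (by simp)
      hU.uniqueMDiffOn).comp h1.contMDiffOn (s := U) (fun y hy => hy)
    refine h2.congr fun y hy => ?_
    simp only [Function.comp, tangentMapWithin, mfderivWithin_of_isOpen hU hy]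
  have hg : ContMDiffOn 𝓘(ℝ, X) (𝓘(ℝ, E).prod 𝓘(ℝ, E →L[ℝ] E →L[ℝ] ℝ)) ∞
      (fun y ↦ Bundle.TotalSpace.mk' (E →L[ℝ] E →L[ℝ] ℝ)
        (E := fun x : M ↦ TangentSpace 𝓘(ℝ, E) x →L[ℝ] TangentSpace 𝓘(ℝ, E) x →L[ℝ] ℝ)
        (ψ y) (g.inner (ψ y))) U := g.contMDiff.comp_contMDiffOn hψ
  have h3 := ContMDiffOn.clm_bundle_apply₂ (F₁ := E) (F₂ := E) (F₃ := ℝ)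
    (E₃ := fun _ : M => ℝ) hg (hsec u) (hsec v)
  intro y hy
  have h4 := h3 y hy
  rw [Bundle.contMDiffWithinAt_totalSpace] at h4
  exact h4.2.contDiffWithinAt

theorem isMetricOn_pullback [FiniteDimensional ℝ X] (hU : IsOpen U)
    (hψ : ContMDiffOn 𝓘(ℝ, X) 𝓘(ℝ, E) ∞ ψ U)
    (hbij : ∀ y ∈ U, Function.Bijective (mfderiv 𝓘(ℝ, X) 𝓘(ℝ, E) ψ y)) :
    IsMetricOn (g.pullback ψ) U where
  isOpen := hU
  contDiffOn := contDiffOn_clm_apply.2 fun u => contDiffOn_clm_apply.2 fun v =>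
    g.contDiffOn_pullback_apply hU hψ u v
  symm y _ u v := g.symm _ _ _
  nondeg y hy u h := by
    have h0 := g.nondeg (ψ y) (mfderiv 𝓘(ℝ, X) 𝓘(ℝ, E) ψ y u) fun v => by
      obtain ⟨w, rfl⟩ := (hbij y hy).2 v
      exact h w
    exact (hbij y hy).1 (h0.trans (map_zero _).symm)

theorem isMetricOn_inChart [FiniteDimensional ℝ E] (p : M) :
    IsMetricOn (g.inChart (chartAt E p)) (chartAt E p).target :=
  g.isMetricOn_pullback (chartAt E p).open_target contMDiffOn_chart_symm fun _ hy =>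
    (mdifferentiable_chart p).symm.mfderiv_bijective hy

/-- `ricciTensor` uses a different chart at each point. Near `y` the map `ψ` read in the chart at `ψ
y` is an isometric local diffeomorphism, so local naturality makes any parametrization compute the
same tensor. -/
theorem ricci_pullback [FiniteDimensional ℝ E] [FiniteDimensional ℝ X] (hU : IsOpen U)
    (hψ : ContMDiffOn 𝓘(ℝ, X) 𝓘(ℝ, E) ∞ ψ U)
    (hbij : ∀ y ∈ U, Function.Bijective (mfderiv 𝓘(ℝ, X) 𝓘(ℝ, E) ψ y)) (hy : y ∈ U) (u v : X) :
    ricci (g.pullback ψ) y u v = g.ricciTensor (ψ y)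
      (mfderiv 𝓘(ℝ, X) 𝓘(ℝ, E) ψ y u) (mfderiv 𝓘(ℝ, X) 𝓘(ℝ, E) ψ y v) := by
  set e := chartAt E (ψ y) with he
  have hmd := mdifferentiable_chart (I := 𝓘(ℝ, E)) (ψ y)
  let V := U ∩ ψ ⁻¹' e.source
  have hV : IsOpen V := hψ.continuousOn.isOpen_inter_preimage hU e.open_source
  have hyV : y ∈ V := ⟨hy, mem_chart_source E (ψ y)⟩
  have hψV : ContMDiffOn 𝓘(ℝ, X) 𝓘(ℝ, E) ∞ ψ V := hψ.mono inter_subset_left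
  have hψd : ∀ z ∈ V, MDifferentiableAt 𝓘(ℝ, X) 𝓘(ℝ, E) ψ z := fun z hz =>
    (hψV.contMDiffAt (hV.mem_nhds hz)).mdifferentiableAt (by simp)
  have hfd : ∀ z ∈ V, ∀ w : X, fderiv ℝ (e ∘ ψ) z w =
      mfderiv 𝓘(ℝ, E) 𝓘(ℝ, E) e (ψ z) (mfderiv 𝓘(ℝ, X) 𝓘(ℝ, E) ψ z w) := by
    intro z hz w
    rw [← mfderiv_eq_fderiv, mfderiv_comp z (hmd.mdifferentiableAt hz.2) (hψd z hz)]
    rfl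
  have hΦ : ContDiffOn ℝ ∞ (e ∘ ψ) V :=
    (contMDiffOn_chart.comp hψV fun z hz => hz.2).contDiffOn
  have hGH : ∀ z ∈ V, ∀ u v, g.pullback ψ z u v =
      g.inChart e ((e ∘ ψ) z) (fderiv ℝ (e ∘ ψ) z u) (fderiv ℝ (e ∘ ψ) z v) := by
    intro z hz u v
    rw [inChart_eq_pullback, ← pullback_comp g (ψ := e.symm) (k := e ∘ ψ) (hmd.mdifferentiableAt_symm (e.map_source hz.2))
      ((hΦ.contDiffAt (hV.mem_nhds hz)).differentiableAt (by simp))]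
    refine congrArg (fun L : X →L[ℝ] X →L[ℝ] ℝ => L u v) (g.pullback_congr ?_)
    filter_upwards [hV.mem_nhds hz] with x hx using (e.left_inv hx.2).symm
  have hb : ∀ z ∈ V, Function.Bijective (fderiv ℝ (e ∘ ψ) z) := by
    intro z hz
    have h1 := (hmd.mfderiv_bijective hz.2).comp (hbij z hz.1)
    exact (funext (hfd z hz) : (fderiv ℝ (e ∘ ψ) z : X → E) = _) ▸ h1
  have key := Spacetime.ricci_pullback (g.isMetricOn_inChart (ψ y)) hV hΦ
    (fun z hz => e.map_source hz.2) hb hGH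
    ((g.isMetricOn_pullback hU hψ hbij).mono hV inter_subset_left) hyV u v
  rw [key, hfd y hyV, hfd y hyV]
  rfl

end LorentzMetric

end

/-! ### Geodesics, the two differential equations, and Lorentzian linear algebra. -/

section

theorem differentiableAt_deriv {E : Type*} [NormedAddCommGroup E] [NormedSpace ℝ E] {c : ℝ → E}
    {t : ℝ} (hc : ContDiffAt ℝ ∞ c t) : DifferentiableAt ℝ (deriv c) t :=
  differentiableAt_clm_apply_const ((contDiffAt_fderiv hc).differentiableAt (by simp)) 1

section Local

variable {E : Type*} [NormedAddCommGroup E] [NormedSpace ℝ E]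
  {G : E → E →L[ℝ] E →L[ℝ] ℝ} {σ : E → ℝ} {U : Set E} {c : ℝ → E} {t : ℝ}

theorem hasDerivAt_fderiv_comp_geodesic (hG : IsMetricOn G U) (hσ : ContDiffOn ℝ ∞ σ U)
    (hc : ContDiffAt ℝ ∞ c t) (hct : c t ∈ U)
    (hgeo : deriv (deriv c) t + christoffel G (c t) (deriv c t) (deriv c t) = 0) :
    HasDerivAt (fun r => fderiv ℝ σ (c r) (deriv c r))
      (hess G σ (c t) (deriv c t) (deriv c t)) t := by
  have hσt := contDiffAt_fderiv (hσ.contDiffAt (hG.isOpen.mem_nhds hct))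
  have h1 : HasDerivAt (fun r => fderiv ℝ σ (c r)) (fderiv ℝ (fderiv ℝ σ) (c t) (deriv c t)) t :=
    (hσt.differentiableAt (by simp)).hasFDerivAt.comp_hasDerivAt t
      (hc.differentiableAt (by simp)).hasDerivAt
  have h2 : HasDerivAt (deriv c) (deriv (deriv c) t) t :=
    (differentiableAt_deriv hc).hasDerivAt
  convert! h1.clm_apply h2 using 1
  rw [eq_neg_of_add_eq_zero_left hgeo, hess_apply, map_neg]
  ring

variable [FiniteDimensional ℝ E]

/-- Along the segment from `y` to `z` the norm of the derivative of `dσ` is at most a constant times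
the norm of `dσ`, so Grönwall's inequality applies. -/
theorem fderiv_eq_zero_of_hess_eq (hG : IsMetricOn G U) (hσ : ContDiffOn ℝ ∞ σ U)
    (hU : Convex ℝ U)
    (hh : ∀ y ∈ U, ∀ u w, hess G σ y u w = fderiv ℝ σ y u * fderiv ℝ σ y w)
    {y z : E} (hy : y ∈ U) (hz : z ∈ U) (h0 : fderiv ℝ σ y = 0) : fderiv ℝ σ z = 0 := by
  set v := z - y with hv
  have hmem : ∀ t ∈ Icc (0 : ℝ) 1, y + t • v ∈ U := fun t ht =>
    hU.add_smul_sub_mem hy hz ht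
  have hsm : ∀ x ∈ U, ContDiffAt ℝ ∞ σ x := fun x hx => hσ.contDiffAt (hG.isOpen.mem_nhds hx)
  have hline : ∀ t : ℝ, HasDerivAt (fun t : ℝ => y + t • v) v t := fun t => by
    simpa using ((hasDerivAt_id t).smul_const v).const_add y
  have hder : ∀ t ∈ Icc (0 : ℝ) 1, HasDerivAt (fun t : ℝ => fderiv ℝ σ (y + t • v))
      (fderiv ℝ (fderiv ℝ σ) (y + t • v) v) t := fun t ht =>
    ((contDiffAt_fderiv (hsm _ (hmem t ht))).differentiableAt
      (by simp)).hasFDerivAt.comp_hasDerivAt t (hline t)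
  -- The term `dσ(v) dσ` is quadratic in `dσ`; one factor goes into the coefficient, which is
  -- bounded on the compact segment.
  have hcont : ContinuousOn (fun t : ℝ => ‖fderiv ℝ σ (y + t • v)‖ * ‖v‖ +
      ‖christoffel G (y + t • v)‖ * ‖v‖) (Icc 0 1) := by
    intro t ht
    have h1 : ContinuousAt (fun t : ℝ => christoffel G (y + t • v)) t :=
      ContinuousAt.comp (f := fun t : ℝ => y + t • v)
        (hG.contDiffAt_christoffel (hmem t ht)).continuousAt (hline t).continuousAt
    exact (((hder t ht).continuousAt.norm.mul_const _).add
      (h1.norm.mul_const _)).continuousWithinAt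
  obtain ⟨K, hK⟩ := isCompact_Icc.exists_bound_of_continuousOn hcont
  have key := eq_zero_of_abs_deriv_le_mul_abs_self_of_eq_zero_right
    (f := fun t : ℝ => fderiv ℝ σ (y + t • v)) (K := K) (a := 0) (b := 1)
    (fun t ht => (hder t ht).continuousAt.continuousWithinAt)
    (fun t ht => (hder t (Ico_subset_Icc_self ht)).hasDerivWithinAt) (by simpa using h0) ?_ 1
    (by simp)
  · simpa [hv] using key
  · intro t ht
    have ht' := Ico_subset_Icc_self ht
    set x := y + t • v
    have e : fderiv ℝ (fderiv ℝ σ) x v =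
        fderiv ℝ σ x v • fderiv ℝ σ x + (fderiv ℝ σ x).comp (christoffel G x v) := by
      ext w
      have := hh x (hmem t ht') v w
      rw [hess_apply] at this
      simp only [add_apply, smul_apply, smul_eq_mul, ContinuousLinearMap.comp_apply]
      linarith
    rw [e]
    calc _ ≤ ‖fderiv ℝ σ x v • fderiv ℝ σ x‖ + ‖(fderiv ℝ σ x).comp (christoffel G x v)‖ :=
          norm_add_le _ _
      _ ≤ ‖fderiv ℝ σ x‖ * ‖v‖ * ‖fderiv ℝ σ x‖ +
          ‖fderiv ℝ σ x‖ * (‖christoffel G x‖ * ‖v‖) := by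
        rw [norm_smul]
        gcongr
        · exact (fderiv ℝ σ x).le_opNorm v
        · exact (ContinuousLinearMap.opNorm_comp_le _ _).trans
            (by gcongr; exact (christoffel G x).le_opNorm v)
      _ = (‖fderiv ℝ σ x‖ * ‖v‖ + ‖christoffel G x‖ * ‖v‖) * ‖fderiv ℝ σ x‖ := by ring
      _ ≤ K * ‖fderiv ℝ σ x‖ := by
        gcongr
        exact (le_abs_self _).trans (hK t ht')

theorem hasDerivAt_energy_geodesic (hG : IsMetricOn G U)
    (hc : ContDiffAt ℝ ∞ c t) (hct : c t ∈ U)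
    (hgeo : deriv (deriv c) t + christoffel G (c t) (deriv c t) (deriv c t) = 0) :
    HasDerivAt (fun r => G (c r) (deriv c r) (deriv c r)) 0 t := by
  have h1 : HasDerivAt (fun r => G (c r)) (fderiv ℝ G (c t) (deriv c t)) t :=
    (hG.differentiableAt hct).hasFDerivAt.comp_hasDerivAt t
      (hc.differentiableAt (by simp)).hasDerivAt
  have h2 : HasDerivAt (deriv c) (deriv (deriv c) t) t :=
    (differentiableAt_deriv hc).hasDerivAt
  convert! (h1.clm_apply h2).clm_apply h2 using 1
  rw [eq_neg_of_add_eq_zero_left hgeo]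
  simp only [add_apply, map_neg, neg_apply, hG.fderiv_apply hct]
  ring

end Local

/-- A positive function on the line with constant second derivative `a`, for which
`2 f a ≤ f' ^ 2`, is constant. -/
theorem eq_zero_of_pos_of_second_deriv {f f' : ℝ → ℝ} {a : ℝ} (hpos : ∀ t, 0 < f t)
    (h1 : ∀ t, HasDerivAt f (f' t) t) (h2 : ∀ t, HasDerivAt f' a t)
    (h : 2 * f 0 * a ≤ f' 0 ^ 2) : a = 0 ∧ f' 0 = 0 := by
  have e1 : ∀ t, f' t = f' 0 + a * t := by
    have hd : ∀ t, HasDerivAt (fun t => f' t - a * t) 0 t := fun t => by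
      convert! (h2 t).sub ((hasDerivAt_id t).const_mul a) using 1
      simp
    intro t
    have := is_const_of_deriv_eq_zero (fun t => (hd t).differentiableAt) (fun t => (hd t).deriv) t 0
    simp only [mul_zero, sub_zero] at this
    linarith
  have e2 : ∀ t, f t = a / 2 * (t * t) + f' 0 * t + f 0 := by
    have hd : ∀ t, HasDerivAt (fun t => f t - (a / 2 * (t * t) + f' 0 * t)) 0 t := fun t => by
      have := (h1 t).sub ((((hasDerivAt_id t).mul (hasDerivAt_id t)).const_mul (a / 2)).add
        ((hasDerivAt_id t).const_mul (f' 0)))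
      convert! this using 1
      rw [e1 t]
      simp only [id]
      ring
    intro t
    have := is_const_of_deriv_eq_zero (fun t => (hd t).differentiableAt) (fun t => (hd t).deriv) t 0
    simp only [mul_zero, sub_zero, add_zero] at this
    linarith
  -- `h` says that the discriminant of `f` is nonnegative, whereas a positive genuine quadratic has
  -- a negative one.
  have ha : a = 0 := by
    by_contra ha
    have := discrim_lt_zero (a := a / 2) (b := f' 0) (c := f 0) (by simpa using ha)
      fun x => e2 x ▸ hpos x
    rw [discrim] at this
    linarith
  refine ⟨ha, ?_⟩
  have := discrim_le_zero (a := a / 2) (b := f' 0) (c := f 0) fun x => (e2 x ▸ hpos x).le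
  rw [discrim, ha] at this
  nlinarith [sq_nonneg (f' 0)]

section Lorentz

variable {E : Type*} [NormedAddCommGroup E] [NormedSpace ℝ E]
  {M : Type*} [TopologicalSpace M] [ChartedSpace E M] [IsManifold 𝓘(ℝ, E) ∞ M]
  (g : LorentzMetric E M)

/-- The signature axiom provides one timelike `e`; this extends it to every timelike `v`. If `g(w,
w) ≤ 0`, the combination `z` of `v` and `w` orthogonal to `e` has `g(z, z) ≤ 0`, so `z = 0`, which
forces `w = 0`. -/
theorem LorentzMetric.pos_of_orthogonal_timelike {x : M} {v w : TangentSpace 𝓘(ℝ, E) x}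
    (hv : g.inner x v v < 0) (hvw : g.inner x v w = 0) (hw : w ≠ 0) : 0 < g.inner x w w := by
  obtain ⟨e, -, he'⟩ := g.signature x
  by_contra! hww
  have hev : g.inner x e v ≠ 0 := fun h => by
    have hv0 : v ≠ 0 := by rintro rfl; simp at hv
    exact absurd (he' v h hv0) hv.not_gt
  set z := g.inner x e w • v - g.inner x e v • w with hz
  have hwv : g.inner x w v = 0 := by rw [g.symm, hvw]
  have hez : g.inner x e z = 0 := by
    simp only [hz, map_sub, map_smul, smul_eq_mul]; ring
  have hzz : g.inner x z z = g.inner x e w ^ 2 * g.inner x v v +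
      g.inner x e v ^ 2 * g.inner x w w := by
    simp only [hz, map_sub, map_smul, sub_apply, smul_apply, smul_eq_mul, hvw, hwv]; ring
  have hz0 : z = 0 := by
    by_contra h
    have := he' z hez h
    rw [hzz] at this
    nlinarith [sq_nonneg (g.inner x e w), sq_nonneg (g.inner x e v)]
  have hvz : g.inner x v z = g.inner x e w * g.inner x v v := by
    simp only [hz, map_sub, map_smul, smul_eq_mul, hvw]; ring
  rw [hz0, map_zero] at hvz
  have hew : g.inner x e w = 0 := by
    rcases mul_eq_zero.1 hvz.symm with h | h
    · exact h
    · exact absurd h hv.ne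
  rw [hew, zero_smul, zero_sub] at hz
  exact hw ((smul_eq_zero.1 (neg_eq_zero.1 (hz.symm.trans hz0))).resolve_left hev)

theorem LorentzMetric.reverse_cauchy_schwarz {x : M} {v : TangentSpace 𝓘(ℝ, E) x}
    (hv : g.inner x v v < 0) (a : TangentSpace 𝓘(ℝ, E) x) :
    g.inner x a a * g.inner x v v ≤ g.inner x a v ^ 2 := by
  -- The component of `a` orthogonal to `v`, scaled by `g(v, v)` to avoid division.
  set w := g.inner x v v • a - g.inner x a v • v with hw
  have hva : g.inner x v a = g.inner x a v := g.symm _ _ _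
  have hvw : g.inner x v w = 0 := by
    simp only [hw, map_sub, map_smul, smul_eq_mul, hva]; ring
  have hww : 0 ≤ g.inner x w w := by
    by_cases h : w = 0
    · simp [h]
    · exact (g.pos_of_orthogonal_timelike hv hvw h).le
  have e : g.inner x w w =
      g.inner x v v * (g.inner x a a * g.inner x v v - g.inner x a v ^ 2) := by
    simp only [hw, map_sub, map_smul, sub_apply, smul_apply, smul_eq_mul, hva]; ring
  rw [e] at hww
  nlinarith

end Lorentz

/-- Local-to-global principle, used for `σ`, for `λ`, and for the proposition that `dσ` vanishes at
a point. -/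
theorem eq_of_eqOn_convex_charts {E : Type*} [NormedAddCommGroup E] [NormedSpace ℝ E]
    {M : Type*} [TopologicalSpace M] [ChartedSpace E M] [ConnectedSpace M] {Y : Type*} (f : M → Y)
    (h : ∀ p : M, ∀ V ⊆ (chartAt E p).target, IsOpen V → Convex ℝ V → ∀ y ∈ V, ∀ z ∈ V,
      f ((chartAt E p).symm y) = f ((chartAt E p).symm z)) (p q : M) : f p = f q := by
  have hl : IsLocallyConstant f := by
    rw [IsLocallyConstant.iff_eventually_eq]
    intro p
    set e := chartAt E p
    obtain ⟨r, hr, hrs⟩ := Metric.isOpen_iff.1 e.open_target (e p) (mem_chart_target E p)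
    have hc : ∀ᶠ q in 𝓝 p, e q ∈ Metric.ball (e p) r :=
      (e.continuousAt (mem_chart_source E p)).eventually (Metric.ball_mem_nhds _ hr)
    filter_upwards [hc, e.open_source.mem_nhds (mem_chart_source E p)] with q hq hqs
    have := h p _ hrs Metric.isOpen_ball (convex_ball _ _) (e q) hq (e p) (Metric.mem_ball_self hr)
    rwa [e.left_inv hqs, e.left_inv (mem_chart_source E p)] at this
  exact hl.apply_eq_of_preconnectedSpace p q

end

/-! ### Gradient and `λ` on the manifold; inverting `φ`; the Hessian equation in charts. -/

section

variable {E : Type*} [NormedAddCommGroup E] [NormedSpace ℝ E]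
  {M : Type*} [TopologicalSpace M] [ChartedSpace E M]
  {F : Type*} [NormedAddCommGroup F] [NormedSpace ℝ F]
  {N : Type*} [TopologicalSpace N] [ChartedSpace F N]

theorem bijective_mfderiv (φ : M ≃ₘ^∞⟮𝓘(ℝ, E), 𝓘(ℝ, F)⟯ N) (p : M) :
    Function.Bijective (mfderiv 𝓘(ℝ, E) 𝓘(ℝ, F) φ p) :=
  (φ.mfderivToContinuousLinearEquiv (by simp) p).bijective

theorem mfderiv_symm_apply (φ : M ≃ₘ^∞⟮𝓘(ℝ, E), 𝓘(ℝ, F)⟯ N) (p : M)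
    (u : TangentSpace 𝓘(ℝ, E) p) :
    (mfderiv 𝓘(ℝ, F) 𝓘(ℝ, E) φ.symm (φ p) (mfderiv 𝓘(ℝ, E) 𝓘(ℝ, F) φ p u) : E) = u := by
  have h1 : mfderiv 𝓘(ℝ, E) 𝓘(ℝ, E) (φ.symm ∘ φ) p u =
      mfderiv 𝓘(ℝ, F) 𝓘(ℝ, E) φ.symm (φ p) (mfderiv 𝓘(ℝ, E) 𝓘(ℝ, F) φ p u) :=
    mfderiv_comp_apply p (φ.symm.mdifferentiable (by simp) _) (φ.mdifferentiable (by simp) _) u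
  have h2 : (φ.symm ∘ φ : M → M) = id := funext φ.symm_apply_apply
  have h3 : (mfderiv 𝓘(ℝ, E) 𝓘(ℝ, E) (φ.symm ∘ φ) p : E →L[ℝ] E) = ContinuousLinearMap.id ℝ E := by
    rw [h2]; exact mfderiv_id
  exact h1.symm.trans (congrArg (fun L : E →L[ℝ] E => L u) h3)

variable [IsManifold 𝓘(ℝ, E) ∞ M]

namespace LorentzMetric

variable (g : LorentzMetric E M) {σ : M → ℝ}

/-- The gradient of a function on a Lorentz manifold. -/
def gradient (σ : M → ℝ) (q : M) : TangentSpace 𝓘(ℝ, E) q :=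
  let B : E →L[ℝ] E →L[ℝ] ℝ := g.inner q
  let α : E →L[ℝ] ℝ := mfderiv 𝓘(ℝ, E) 𝓘(ℝ, ℝ) σ q
  B.inverse α

/-- The function `e^{-σ} |dσ|² / 2` on a Lorentz manifold. -/
def factor (σ : M → ℝ) (q : M) : ℝ :=
  Real.exp (-σ q) * g.inner q (g.gradient σ q) (g.gradient σ q) / 2

theorem apply_gradient [FiniteDimensional ℝ E] (q : M) (w : TangentSpace 𝓘(ℝ, E) q) :
    g.inner q (g.gradient σ q) w = mfderiv 𝓘(ℝ, E) 𝓘(ℝ, ℝ) σ q w := by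
  -- A single form is a constant metric field, so the local lemmas apply.
  have h : IsMetricOn (fun _ : E => (g.inner q : E →L[ℝ] E →L[ℝ] ℝ)) univ :=
    ⟨isOpen_univ, contDiffOn_const, fun _ _ => g.symm q, fun _ _ => g.nondeg q⟩
  exact h.apply_inverse (mem_univ 0) _ w

theorem fderiv_comp_chart_symm (hσ : ContMDiff 𝓘(ℝ, E) 𝓘(ℝ, ℝ) ∞ σ) (p : M) {y : E}
    (hy : y ∈ (chartAt E p).target) (w : E) :
    fderiv ℝ (σ ∘ (chartAt E p).symm) y w = mfderiv 𝓘(ℝ, E) 𝓘(ℝ, ℝ) σ ((chartAt E p).symm y)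
      (mfderiv 𝓘(ℝ, E) 𝓘(ℝ, E) (chartAt E p).symm y w) := by
  rw [← mfderiv_eq_fderiv, mfderiv_comp y (hσ.mdifferentiableAt (by simp))
    ((mdifferentiable_chart p).mdifferentiableAt_symm hy)]
  rfl

theorem contDiffOn_comp_chart_symm (hσ : ContMDiff 𝓘(ℝ, E) 𝓘(ℝ, ℝ) ∞ σ) (p : M) :
    ContDiffOn ℝ ∞ (σ ∘ (chartAt E p).symm) (chartAt E p).target :=
  (hσ.comp_contMDiffOn contMDiffOn_chart_symm).contDiffOn

variable [FiniteDimensional ℝ E]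

theorem mfderiv_grad (hσ : ContMDiff 𝓘(ℝ, E) 𝓘(ℝ, ℝ) ∞ σ) (p : M) {y : E}
    (hy : y ∈ (chartAt E p).target) :
    mfderiv 𝓘(ℝ, E) 𝓘(ℝ, E) (chartAt E p).symm y
      (grad (E := E) (g.inChart (chartAt E p)) (σ ∘ (chartAt E p).symm) y) =
      g.gradient σ ((chartAt E p).symm y) := by
  refine sub_eq_zero.1 (g.nondeg _ _ fun v => ?_)
  obtain ⟨w, rfl⟩ : ∃ w : E, mfderiv 𝓘(ℝ, E) 𝓘(ℝ, E) (chartAt E p).symm y w = v :=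
    ((mdifferentiable_chart p).symm.mfderiv_bijective hy).2 v
  have h1 := (g.isMetricOn_inChart p).apply_grad (σ := σ ∘ (chartAt E p).symm) hy w
  rw [fderiv_comp_chart_symm hσ p hy, ← g.apply_gradient] at h1
  rw [map_sub, sub_apply, sub_eq_zero]
  exact h1

theorem concircularFactor_eq (hσ : ContMDiff 𝓘(ℝ, E) 𝓘(ℝ, ℝ) ∞ σ) (p : M) {y : E}
    (hy : y ∈ (chartAt E p).target) :
    concircularFactor (g.inChart (chartAt E p)) (σ ∘ (chartAt E p).symm) y =
      g.factor σ ((chartAt E p).symm y) := by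
  rw [concircularFactor, factor, fderiv_comp_chart_symm hσ p hy, g.mfderiv_grad hσ p hy,
    g.apply_gradient]
  rfl

end LorentzMetric

theorem inner_symm_mfderiv (g : LorentzMetric E M) (φ : M ≃ₘ^∞⟮𝓘(ℝ, E), 𝓘(ℝ, F)⟯ N) (p : M)
    (u v : TangentSpace 𝓘(ℝ, E) p) :
    g.inner (φ.symm (φ p))
      (mfderiv 𝓘(ℝ, F) 𝓘(ℝ, E) φ.symm (φ p) (mfderiv 𝓘(ℝ, E) 𝓘(ℝ, F) φ p u))
      (mfderiv 𝓘(ℝ, F) 𝓘(ℝ, E) φ.symm (φ p) (mfderiv 𝓘(ℝ, E) 𝓘(ℝ, F) φ p v)) =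
      g.inner p u v := by
  -- The tangent space depends on the base point, and `φ.symm (φ p) = p` holds only propositionally;
  -- hence a variable `x`.
  have key : ∀ x : M, x = p → ∀ a b : E, a = u → b = v →
      (g.inner x : E →L[ℝ] E →L[ℝ] ℝ) a b = g.inner p u v := by rintro _ rfl _ _ rfl rfl; rfl
  exact key _ (φ.symm_apply_apply p) _ _ (mfderiv_symm_apply φ p u) (mfderiv_symm_apply φ p v)

theorem ricciTensor_symm_mfderiv (g : LorentzMetric E M) (φ : M ≃ₘ^∞⟮𝓘(ℝ, E), 𝓘(ℝ, F)⟯ N) (p : M)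
    (u v : TangentSpace 𝓘(ℝ, E) p) :
    g.ricciTensor (φ.symm (φ p))
      (mfderiv 𝓘(ℝ, F) 𝓘(ℝ, E) φ.symm (φ p) (mfderiv 𝓘(ℝ, E) 𝓘(ℝ, F) φ p u))
      (mfderiv 𝓘(ℝ, F) 𝓘(ℝ, E) φ.symm (φ p) (mfderiv 𝓘(ℝ, E) 𝓘(ℝ, F) φ p v)) =
      g.ricciTensor p u v := by
  have key : ∀ x : M, x = p → ∀ a b : E, a = u → b = v →
      (g.ricciTensor x : E → E → ℝ) a b = g.ricciTensor p u v := by rintro _ rfl _ _ rfl rfl; rfl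
  exact key _ (φ.symm_apply_apply p) _ _ (mfderiv_symm_apply φ p u) (mfderiv_symm_apply φ p v)

variable [IsManifold 𝓘(ℝ, F) ∞ N] {g : LorentzMetric E M} {h : LorentzMetric F N} {φ : M ≃ₘ^∞⟮𝓘(ℝ, E), 𝓘(ℝ, F)⟯ N}
  {σ : M → ℝ}

theorem IsConformal.symm (hc : IsConformal g h φ) : IsConformal h g φ.symm := by
  obtain ⟨σ, hσ, hc⟩ := hc
  refine ⟨fun q => -σ (φ.symm q), (hσ.comp φ.symm.contMDiff).neg, fun q u v => ?_⟩
  obtain ⟨p, rfl⟩ : ∃ p, φ p = q := ⟨_, φ.apply_symm_apply q⟩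
  obtain ⟨u, rfl⟩ := (bijective_mfderiv φ p).2 u
  obtain ⟨v, rfl⟩ := (bijective_mfderiv φ p).2 v
  simp only [φ.symm_apply_apply]
  rw [inner_symm_mfderiv, hc, ← mul_assoc, ← Real.exp_add]
  simp

theorem PreservesRicci.symm (hr : PreservesRicci g h φ) : PreservesRicci h g φ.symm := by
  intro q u v
  obtain ⟨p, rfl⟩ : ∃ p, φ p = q := ⟨_, φ.apply_symm_apply q⟩
  obtain ⟨u, rfl⟩ := (bijective_mfderiv φ p).2 u
  obtain ⟨v, rfl⟩ := (bijective_mfderiv φ p).2 v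
  rw [ricciTensor_symm_mfderiv, hr]

theorem IsHomothety.of_symm (hh : IsHomothety h g φ.symm) : IsHomothety g h φ := by
  obtain ⟨c, hc, hh⟩ := hh
  refine ⟨c⁻¹, inv_pos.2 hc, fun p u v => ?_⟩
  rw [← inner_symm_mfderiv g φ p u v, hh, inv_mul_cancel_left₀ hc.ne']

variable [FiniteDimensional ℝ E] [FiniteDimensional ℝ F]

/-- Both metrics are brought to the same chart target, `h` through `φ ∘ e.symm`, where they are
conformal with equal Ricci tensors. -/
theorem hess_of_preservesRicci (hE : 2 < Module.finrank ℝ E)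
    (hσ : ContMDiff 𝓘(ℝ, E) 𝓘(ℝ, ℝ) ∞ σ)
    (hc : ∀ (p : M) (u v : TangentSpace 𝓘(ℝ, E) p),
      h.inner (φ p) (mfderiv 𝓘(ℝ, E) 𝓘(ℝ, F) φ p u) (mfderiv 𝓘(ℝ, E) 𝓘(ℝ, F) φ p v) =
        Real.exp (2 * σ p) * g.inner p u v)
    (hr : PreservesRicci g h φ) (p : M) {y : E} (hy : y ∈ (chartAt E p).target) (u w : E) :
    hess (g.inChart (chartAt E p)) (σ ∘ (chartAt E p).symm) y u w =
      fderiv ℝ (σ ∘ (chartAt E p).symm) y u * fderiv ℝ (σ ∘ (chartAt E p).symm) y w -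
      fderiv ℝ (σ ∘ (chartAt E p).symm) y
        (grad (g.inChart (chartAt E p)) (σ ∘ (chartAt E p).symm) y) / 2 *
        g.inChart (chartAt E p) y u w := by
  set e := chartAt E p with he
  have hmd := (mdifferentiable_chart (I := 𝓘(ℝ, E)) p).symm
  have hψ : ContMDiffOn 𝓘(ℝ, E) 𝓘(ℝ, F) ∞ (φ ∘ e.symm) e.target :=
    φ.contMDiff.comp_contMDiffOn contMDiffOn_chart_symm
  have hd : ∀ z ∈ e.target, ∀ u : E, mfderiv 𝓘(ℝ, E) 𝓘(ℝ, F) (φ ∘ e.symm) z u =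
      mfderiv 𝓘(ℝ, E) 𝓘(ℝ, F) φ (e.symm z) (mfderiv 𝓘(ℝ, E) 𝓘(ℝ, E) e.symm z u) :=
    fun z hz u => mfderiv_comp_apply z (φ.mdifferentiable (by simp) _) (hmd.mdifferentiableAt hz) u
  have hbij : ∀ z ∈ e.target, Function.Bijective (mfderiv 𝓘(ℝ, E) 𝓘(ℝ, F) (φ ∘ e.symm) z) := by
    intro z hz
    exact (funext (hd z hz) : (mfderiv 𝓘(ℝ, E) 𝓘(ℝ, F) (φ ∘ e.symm) z : E → F) = _) ▸
      (bijective_mfderiv φ (e.symm z)).comp (hmd.mfderiv_bijective hz)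
  refine hess_of_ricci_eq hE (g.isMetricOn_inChart p)
    (h.isMetricOn_pullback e.open_target hψ hbij)
    (LorentzMetric.contDiffOn_comp_chart_symm hσ p) (fun z hz u v => ?_) (fun z hz u v => ?_) hy u w
  · rw [h.pullback_apply, hd z hz, hd z hz]
    exact hc _ _ _
  · rw [h.ricci_pullback e.open_target hψ hbij hz, hd z hz, hd z hz, g.inChart_eq_pullback,
      g.ricci_pullback e.open_target contMDiffOn_chart_symm
        (fun z hz => hmd.mfderiv_bijective hz) hz]
    exact hr _ _ _

end

/-! ### The argument along a complete timelike geodesic, and its globalization. -/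

section

variable {E : Type*} [NormedAddCommGroup E] [NormedSpace ℝ E]
  {M : Type*} [TopologicalSpace M] [ChartedSpace E M] {γ : ℝ → M}

theorem eventually_mem_chart_source (hγ : ContMDiff 𝓘(ℝ, ℝ) 𝓘(ℝ, E) ∞ γ) (t : ℝ) :
    ∀ᶠ r in 𝓝 t, γ r ∈ (chartAt E (γ t)).source :=
  hγ.continuous.continuousAt.eventually
    ((chartAt E (γ t)).open_source.mem_nhds (mem_chart_source E (γ t)))

theorem chart_symm_comp_eventuallyEq (hγ : ContMDiff 𝓘(ℝ, ℝ) 𝓘(ℝ, E) ∞ γ) (t : ℝ) :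
    γ =ᶠ[𝓝 t] (chartAt E (γ t)).symm ∘ (chartAt E (γ t) ∘ γ) := by
  filter_upwards [eventually_mem_chart_source hγ t] with r hr using
    ((chartAt E (γ t)).left_inv hr).symm

variable [IsManifold 𝓘(ℝ, E) ∞ M] {g : LorentzMetric E M} {σ : M → ℝ}

theorem contDiffAt_chart_comp (hγ : ContMDiff 𝓘(ℝ, ℝ) 𝓘(ℝ, E) ∞ γ) (t : ℝ)
    {r : ℝ} (hr : γ r ∈ (chartAt E (γ t)).source) :
    ContDiffAt ℝ ∞ (chartAt E (γ t) ∘ γ) r :=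
  ((contMDiffOn_chart.contMDiffAt ((chartAt E (γ t)).open_source.mem_nhds hr)).comp r
    hγ.contMDiffAt).contDiffAt

theorem pullback_curve_eventuallyEq (hγ : ContMDiff 𝓘(ℝ, ℝ) 𝓘(ℝ, E) ∞ γ) (t : ℝ) :
    (fun r => g.pullback γ r 1 1) =ᶠ[𝓝 t] fun r => g.inChart (chartAt E (γ t))
      ((chartAt E (γ t) ∘ γ) r) (deriv (chartAt E (γ t) ∘ γ) r) (deriv (chartAt E (γ t) ∘ γ) r) := by
  filter_upwards [(chart_symm_comp_eventuallyEq hγ t).eventuallyEq_nhds,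
    eventually_mem_chart_source hγ t] with r hr hrs
  rw [g.pullback_congr hr, g.pullback_comp
    (ψ := (chartAt E (γ t)).symm) (k := chartAt E (γ t) ∘ γ)
    ((mdifferentiable_chart (γ t)).mdifferentiableAt_symm ((chartAt E (γ t)).map_source hrs))
    ((contDiffAt_chart_comp hγ t hrs).differentiableAt (by simp))]
  rfl

theorem deriv_comp_curve_eventuallyEq (hγ : ContMDiff 𝓘(ℝ, ℝ) 𝓘(ℝ, E) ∞ γ) (t : ℝ)
    (hσ : ContMDiff 𝓘(ℝ, E) 𝓘(ℝ, ℝ) ∞ σ) :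
    deriv (σ ∘ γ) =ᶠ[𝓝 t] fun r => fderiv ℝ (σ ∘ (chartAt E (γ t)).symm)
      ((chartAt E (γ t) ∘ γ) r) (deriv (chartAt E (γ t) ∘ γ) r) := by
  filter_upwards [(chart_symm_comp_eventuallyEq hγ t).eventuallyEq_nhds,
    eventually_mem_chart_source hγ t] with r hr hrs
  rw [(hr.fun_comp σ).deriv_eq]
  have ht := (chartAt E (γ t)).map_source hrs
  exact fderiv_comp_deriv r (((LorentzMetric.contDiffOn_comp_chart_symm hσ (γ t)).contDiffAt
    ((chartAt E (γ t)).open_target.mem_nhds ht)).differentiableAt (by simp))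
    ((contDiffAt_chart_comp hγ t hrs).differentiableAt (by simp))

theorem eq_of_mfderiv_eq_zero [ConnectedSpace M] (hσ : ContMDiff 𝓘(ℝ, E) 𝓘(ℝ, ℝ) ∞ σ)
    (h0 : ∀ q, (mfderiv 𝓘(ℝ, E) 𝓘(ℝ, ℝ) σ q : E →L[ℝ] ℝ) = 0) (p q : M) : σ p = σ q := by
  refine eq_of_eqOn_convex_charts (E := E) σ (fun p V hVt hV hVc y hy z hz => ?_) p q
  refine hVc.is_const_of_fderivWithin_eq_zero (𝕜 := ℝ) (f := σ ∘ (chartAt E p).symm)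
    (((LorentzMetric.contDiffOn_comp_chart_symm hσ p).mono hVt).differentiableOn (by simp))
    (fun x hx => ?_) hy hz
  rw [fderivWithin_of_isOpen hV hx]
  ext w
  exact (LorentzMetric.fderiv_comp_chart_symm hσ p (hVt hx) w).trans
    (congrArg (fun L : E →L[ℝ] ℝ => L _) (h0 _))

variable [FiniteDimensional ℝ E]

/-- The function `σ` satisfies `∇²σ = dσ ⊗ dσ - ½ |dσ|² g` in every preferred chart; equivalently
`e^{-σ}` has Hessian `λ g` with `λ` the factor `e^{-σ} |dσ|² / 2`. -/
def IsConcircular (g : LorentzMetric E M) (σ : M → ℝ) : Prop :=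
  ∀ (p : M), ∀ y ∈ (chartAt E p).target, ∀ u w : E,
    hess (g.inChart (chartAt E p)) (σ ∘ (chartAt E p).symm) y u w =
      fderiv ℝ (σ ∘ (chartAt E p).symm) y u * fderiv ℝ (σ ∘ (chartAt E p).symm) y w -
      fderiv ℝ (σ ∘ (chartAt E p).symm) y
        (grad (g.inChart (chartAt E p)) (σ ∘ (chartAt E p).symm) y) / 2 *
        g.inChart (chartAt E p) y u w

theorem IsConcircular.factor_eq [ConnectedSpace M] (hσ : ContMDiff 𝓘(ℝ, E) 𝓘(ℝ, ℝ) ∞ σ)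
    (hh : IsConcircular g σ) (p q : M) : g.factor σ p = g.factor σ q := by
  refine eq_of_eqOn_convex_charts (E := E) (g.factor σ) (fun p V hVt hV hVc y hy z hz => ?_) p q
  rw [← g.concircularFactor_eq hσ p (hVt hy), ← g.concircularFactor_eq hσ p (hVt hz)]
  have hd := fun x hx => fderiv_concircularFactor (g.isMetricOn_inChart p)
    (LorentzMetric.contDiffOn_comp_chart_symm hσ p) (hh p) (y := x) hx
  exact hVc.is_const_of_fderivWithin_eq_zero (𝕜 := ℝ)
    (fun x hx => (hd x (hVt hx)).differentiableAt.differentiableWithinAt)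
    (fun x hx => by rw [fderivWithin_of_isOpen hV hx, (hd x (hVt hx)).fderiv]) hy hz

theorem LorentzMetric.IsCompleteGeodesic.hasDerivAt_energy (hγ : g.IsCompleteGeodesic γ) (t : ℝ) :
    HasDerivAt (fun r => g.pullback γ r 1 1) 0 t :=
  (hasDerivAt_energy_geodesic (g.isMetricOn_inChart (γ t))
    (contDiffAt_chart_comp hγ.1 t (mem_chart_source E (γ t))) (mem_chart_target E (γ t))
    (hγ.2 t)).congr_of_eventuallyEq (pullback_curve_eventuallyEq hγ.1 t)

/-- On a geodesic the second derivative is `∇²σ(γ', γ')`, and `|dσ|²/2 = e^σ λ`. -/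
theorem IsConcircular.hasDerivAt_deriv (hσ : ContMDiff 𝓘(ℝ, E) 𝓘(ℝ, ℝ) ∞ σ)
    (hh : IsConcircular g σ) (hγ : g.IsCompleteGeodesic γ) (t : ℝ) :
    HasDerivAt (deriv (σ ∘ γ)) (deriv (σ ∘ γ) t ^ 2 -
      Real.exp (σ (γ t)) * g.factor σ (γ t) * g.pullback γ t 1 1) t := by
  have h1 := (hasDerivAt_fderiv_comp_geodesic (g.isMetricOn_inChart (γ t))
    (LorentzMetric.contDiffOn_comp_chart_symm hσ (γ t))
    (contDiffAt_chart_comp hγ.1 t (mem_chart_source E (γ t))) (mem_chart_target E (γ t))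
    (hγ.2 t)).congr_of_eventuallyEq (deriv_comp_curve_eventuallyEq hγ.1 t hσ)
  convert! h1 using 1
  have hl := (chartAt E (γ t)).left_inv (mem_chart_source E (γ t))
  have h2 := g.concircularFactor_eq hσ (γ t) (mem_chart_target E (γ t))
  rw [hl] at h2
  rw [← h2, (deriv_comp_curve_eventuallyEq hγ.1 t hσ).eq_of_nhds,
    (pullback_curve_eventuallyEq (g := g) hγ.1 t).eq_of_nhds]
  simp only [Function.comp_apply]
  rw [hh (γ t) _ (mem_chart_target E (γ t)), concircularFactor]
  simp only [Function.comp_apply, hl, Real.exp_neg]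
  field_simp

theorem IsConcircular.mfderiv_eq_zero_of_viable [ConnectedSpace M]
    (hσ : ContMDiff 𝓘(ℝ, E) 𝓘(ℝ, ℝ) ∞ σ) (hh : IsConcircular g σ) (hg : g.IsViable) (q : M) :
    (mfderiv 𝓘(ℝ, E) 𝓘(ℝ, ℝ) σ q : E →L[ℝ] ℝ) = 0 := by
  obtain ⟨γ, hγ, htime⟩ := hg
  set p := γ 0 with hp
  set v : TangentSpace 𝓘(ℝ, E) p := mfderiv 𝓘(ℝ, ℝ) 𝓘(ℝ, E) γ 0 (1 : ℝ) with hv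
  set A := g.gradient σ p with hA
  set k := g.inner p v v with hk
  have hk0 : k < 0 := htime 0
  have hK : ∀ t, g.pullback γ t 1 1 = k := fun t =>
    is_const_of_deriv_eq_zero (fun t => (hγ.hasDerivAt_energy t).differentiableAt)
      (fun t => (hγ.hasDerivAt_energy t).deriv) t 0
  have hS : ∀ t, HasDerivAt (σ ∘ γ) (deriv (σ ∘ γ) t) t := fun t =>
    (((hσ.comp hγ.1).contDiff).differentiable (by simp) t).hasDerivAt
  have hS0 : deriv (σ ∘ γ) 0 = g.inner p A v := by
    have h0 := mfderiv_comp_apply (0 : ℝ) (hσ.mdifferentiableAt (x := γ 0) (by simp))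
      (hγ.1.mdifferentiableAt (by simp)) (1 : ℝ)
    rw [mfderiv_eq_fderiv] at h0
    exact h0.trans (g.apply_gradient (σ := σ) p v).symm
  have hAA : g.inner p A A = 2 * Real.exp (σ p) * g.factor σ p := by
    rw [LorentzMetric.factor, Real.exp_neg]
    field_simp
    rfl
  have h1 : ∀ t, HasDerivAt (fun t => Real.exp (-σ (γ t)))
      (-(Real.exp (-σ (γ t)) * deriv (σ ∘ γ) t)) t := fun t => by
    convert! (hS t).neg.exp using 1
    simp
  -- For `f = e^{-σ}` the square of the first derivative drops out, leaving `(f ∘ γ)'' = λk`.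
  have h2 : ∀ t, HasDerivAt (fun t => -(Real.exp (-σ (γ t)) * deriv (σ ∘ γ) t))
      (g.factor σ p * k) t := fun t => by
    convert! ((h1 t).mul (hh.hasDerivAt_deriv hσ hγ t)).neg using 1
    rw [hK, hh.factor_eq hσ (γ t) p, Real.exp_neg]
    field_simp
    ring
  have hcs := g.reverse_cauchy_schwarz hk0 A
  rw [← hS0, hAA, ← hk] at hcs
  obtain ⟨h3, h4⟩ := eq_zero_of_pos_of_second_deriv (fun t => Real.exp_pos _) h1 h2 (by
    -- The reverse Cauchy-Schwarz inequality times `e^{-2σ}` is the discriminant condition.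
    rw [neg_sq, mul_pow, sq (Real.exp _), ← hp]
    have : Real.exp (-σ p) * Real.exp (-σ p) * (2 * Real.exp (σ p) * g.factor σ p * k) =
        2 * Real.exp (-σ p) * (g.factor σ p * k) := by
      rw [Real.exp_neg]; field_simp
    rw [← this]
    exact mul_le_mul_of_nonneg_left hcs (by positivity))
  have hfac : g.factor σ p = 0 := (mul_eq_zero.1 h3).resolve_right hk0.ne
  have hS1 : deriv (σ ∘ γ) 0 = 0 :=
    (mul_eq_zero.1 (neg_eq_zero.1 h4)).resolve_left (Real.exp_pos _).ne'
  -- A nonzero vector orthogonal to `γ'` would be spacelike, but `λ = 0` makes `A` null.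
  have hA0 : A = 0 := by
    by_contra hne
    have := g.pos_of_orthogonal_timelike hk0 (by rw [g.symm, ← hS0, hS1]) hne
    rw [hAA, hfac, mul_zero] at this
    exact this.false
  have hp0 : (mfderiv 𝓘(ℝ, E) 𝓘(ℝ, ℝ) σ p : E →L[ℝ] ℝ) = 0 := by
    ext w
    refine (g.apply_gradient (σ := σ) p w).symm.trans ?_
    rw [← hA, hA0, map_zero]
    rfl
  -- The principle is applied to a `Prop`-valued function; equality of its values is an equivalence,
  -- proved by propagating the zero both ways.
  have key := eq_of_eqOn_convex_charts (E := E)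
    (fun q => (mfderiv 𝓘(ℝ, E) 𝓘(ℝ, ℝ) σ q : E →L[ℝ] ℝ) = 0) ?_ p q
  · exact key ▸ hp0
  intro p' V hVt hV hVc y hy z hz
  have hG := (g.isMetricOn_inChart p').mono hV hVt
  have hs := (LorentzMetric.contDiffOn_comp_chart_symm hσ p').mono hVt
  have hh' : ∀ y ∈ V, ∀ u w, hess (g.inChart (chartAt E p')) (σ ∘ (chartAt E p').symm) y u w =
      fderiv ℝ (σ ∘ (chartAt E p').symm) y u * fderiv ℝ (σ ∘ (chartAt E p').symm) y w := by
    intro y hy u w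
    have h5 := g.concircularFactor_eq hσ p' (hVt hy)
    rw [hh.factor_eq hσ _ p, hfac, concircularFactor, div_eq_zero_iff, mul_eq_zero] at h5
    have h6 := (h5.resolve_right two_ne_zero).resolve_left (Real.exp_pos _).ne'
    rw [hh p' y (hVt hy), h6]
    ring
  have hiff : ∀ y ∈ V, (mfderiv 𝓘(ℝ, E) 𝓘(ℝ, ℝ) σ ((chartAt E p').symm y) : E →L[ℝ] ℝ) = 0 ↔
      fderiv ℝ (σ ∘ (chartAt E p').symm) y = 0 := by
    intro y hy
    have hf := LorentzMetric.fderiv_comp_chart_symm hσ p' (hVt hy)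
    constructor
    · intro h0
      ext w
      exact (hf w).trans (congrArg (fun L : E →L[ℝ] ℝ => L _) h0)
    · intro h0
      ext w
      obtain ⟨u, rfl⟩ := ((mdifferentiable_chart p').symm.mfderiv_bijective (hVt hy)).2 w
      exact (hf u).symm.trans (congrArg (fun L : E →L[ℝ] ℝ => L _) h0)
  rw [hiff y hy, hiff z hz]
  exact propext ⟨fderiv_eq_zero_of_hess_eq hG hs hVc hh' hy hz,
    fderiv_eq_zero_of_hess_eq hG hs hVc hh' hz hy⟩

theorem isHomothety_of_isViable {F : Type*} [NormedAddCommGroup F] [NormedSpace ℝ F]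
    [FiniteDimensional ℝ F] {N : Type*} [TopologicalSpace N] [ChartedSpace F N]
    [IsManifold 𝓘(ℝ, F) ∞ N] [ConnectedSpace M] {h : LorentzMetric F N}
    {φ : M ≃ₘ^∞⟮𝓘(ℝ, E), 𝓘(ℝ, F)⟯ N} (hE : 2 < Module.finrank ℝ E)
    (hc : IsConformal g h φ) (hr : PreservesRicci g h φ) (hg : g.IsViable) :
    IsHomothety g h φ := by
  obtain ⟨σ, hσ, hc⟩ := hc
  have hh : IsConcircular g σ := fun p y hy u w => hess_of_preservesRicci hE hσ hc hr p hy u w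
  have hconst := eq_of_mfderiv_eq_zero hσ (hh.mfderiv_eq_zero_of_viable hσ hg)
  obtain ⟨p₀⟩ : Nonempty M := inferInstance
  exact ⟨Real.exp (2 * σ p₀), Real.exp_pos _, fun p u v => by rw [hc, hconst p p₀]⟩

end

end Spacetime

end

theorem mainTheorem2
    {E : Type*} [NormedAddCommGroup E] [NormedSpace ℝ E] [FiniteDimensional ℝ E]
    {F : Type*} [NormedAddCommGroup F] [NormedSpace ℝ F] [FiniteDimensional ℝ F]
    (hE : 2 < Module.finrank ℝ E) (hF : 2 < Module.finrank ℝ F)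
    {M : Type*} [TopologicalSpace M] [ChartedSpace E M] [IsManifold 𝓘(ℝ, E) ∞ M]
    [T2Space M] [ConnectedSpace M]
    {N : Type*} [TopologicalSpace N] [ChartedSpace F N] [IsManifold 𝓘(ℝ, F) ∞ N]
    [T2Space N] [ConnectedSpace N]
    (g : Spacetime.LorentzMetric E M) (h : Spacetime.LorentzMetric F N)
    (φ : M ≃ₘ^∞⟮𝓘(ℝ, E), 𝓘(ℝ, F)⟯ N)
    (hconf : Spacetime.IsConformal g h φ)
    (hric : Spacetime.PreservesRicci g h φ)
    (hviable : g.IsViable ∨ h.IsViable) :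
    Spacetime.IsHomothety g h φ := by
  rcases hviable with hg | hh
  · exact Spacetime.isHomothety_of_isViable hE hconf hric hg
  · exact (Spacetime.isHomothety_of_isViable hF hconf.symm hric.symm hh).of_symm
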